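/- Let $N,k\ge 0$ be integers, $r>1$, and let $f$ be holomorphic on the open Euclidean ball $B_c(0,r)\subset\mathbb C^N$. The Chebyshev degree $d_f(r)$ of $f$ in $B_c(0,1)$ is the optimal constant (the infimum in $[0,\infty]$ of all $d>0$) for which $$\sup_I|f|\le\Big(\frac{4|I|}{|\omega|}\Big)^{d}\sup_\omega|f|$$ holds for every real segment $I\subset B_c(0,1)$ (where $\mathbb C^N\cong\mathbb R^{2N}$) and every measurable $\omega\subset I$ with $|\omega|>0$; here $|\cdot|$ is length. Let $\mathbb R^k\subset\mathbb C^N$ be a real $k$-dimensional affine subspace, $V\subset B_c(0,1)\cap\mathbb R^k$ a $k$-dimensional convex body (compact, convex, with nonempty interior in $\mathbb R^k$), and $h:\mathbb R^k\to[0,\infty)$ a log-concave function (that is, $K=\{h>0\}$ is convex and $\log h$ is concave on $K$) supported on $V$, i.e. $\{h>0\}\subset V$. Let $\mu_h$ be the measure on $\mathbb R^k$ with density $h$ with respect to Lebesgue measure, and assume $|V|:=\mu_h(V)>0$. Let $m,n,p,q>0$ be real numbers with $$mn=pq,\qquad p<\frac1{d_f(r)}$$ (where $1/0=\infty$ and $1/\infty=0$).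 Then $$\Big(\frac1{|V|}\int_V|f|^m\,d\mu_h\Big)^{n}\Big(\frac1{|V|}\int_V|f|^{-p}\,d\mu_h\Big)^{q}\le(2e)^{n+q}\,4^{(mn+pq)d_f(r)}\,\frac{\Gamma(m\,d_f(r)+1)^{n}}{(1-p\,d_f(r))^{q}},$$ where $\Gamma(x)=\int_0^\infty t^{x-1}e^{-t}\,dt$, $|f|^{-p}=\infty$ at the zeros of $f$, and $0\cdot\infty=0$ (relevant only if $f$ vanishes almost everywhere on $V$ with respect to $\mu_h$). -/

import Mathlib

open MeasureTheory
open scoped ENNReal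

/-- `IsRemezExponent f d`: for every real segment `I = [a, b]` in the open unit ball of `ℂ^N`
and every measurable `ω ⊆ I` of positive length,
`sup_I |f| ≤ (4 |I| / |ω|) ^ d * sup_ω |f|`.
Length is the one-dimensional Hausdorff measure; suprema are taken in `[0, ∞]`. -/
def IsRemezExponent {N : ℕ} (f : EuclideanSpace ℂ (Fin N) → ℂ) (d : ℝ) : Prop :=
  ∀ a ∈ Metric.ball (0 : EuclideanSpace ℂ (Fin N)) 1,
  ∀ b ∈ Metric.ball (0 : EuclideanSpace ℂ (Fin N)) 1,
  ∀ ω : Set (EuclideanSpace ℂ (Fin N)), ω ⊆ segment ℝ a b → MeasurableSet ω → μH[1] ω ≠ 0 →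
    (⨆ z ∈ segment ℝ a b, ‖f z‖ₑ) ≤
      (4 * μH[1] (segment ℝ a b) / μH[1] ω) ^ d * ⨆ z ∈ ω, ‖f z‖ₑ

/-- The Chebyshev degree of `f` in the unit ball: the optimal (least) exponent `d` in the
Remez-type inequality above, as an infimum in `[0, ∞]`. -/
noncomputable def chebyshevDegree {N : ℕ} (f : EuclideanSpace ℂ (Fin N) → ℂ) : ℝ≥0∞ :=
  ⨅ (d : ℝ) (_ : 0 < d ∧ IsRemezExponent f d), ENNReal.ofReal d

/-- `h ≥ 0` is log-concave: `{h > 0}` is convex and `log h` is concave on it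
(`ConcaveOn` includes the convexity of the set). -/
def IsLogConcave {k : ℕ} (h : EuclideanSpace ℝ (Fin k) → ℝ) : Prop :=
  (∀ x, 0 ≤ h x) ∧ ConcaveOn ℝ {x | 0 < h x} (fun x => Real.log (h x))

/-- The measure on `ℝ^k` with density `h` with respect to Lebesgue measure. -/
noncomputable def densityMeasure {k : ℕ} (h : EuclideanSpace ℝ (Fin k) → ℝ) :
    Measure (EuclideanSpace ℝ (Fin k)) :=
  volume.withDensity (fun x => ENNReal.ofReal (h x))

/-- The average `(1 / |V|) ∫_V |g| ^ s dμ` with `|V| = μ(V)`, valued in `[0, ∞]`;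
for `s < 0` the integrand is `∞` at the zeros of `g`. -/
noncomputable def powerAverage {k : ℕ} (μ : Measure (EuclideanSpace ℝ (Fin k)))
    (V : Set (EuclideanSpace ℝ (Fin k))) (g : EuclideanSpace ℝ (Fin k) → ℂ) (s : ℝ) : ℝ≥0∞ :=
  (μ V)⁻¹ * ∫⁻ x in V, ‖g x‖ₑ ^ s ∂μ

/-! The inequality reduces to the line, where both moments are measured against one level `S`. For
mn = pq the powers S^(mn) and S^(-pq) then cancel in the product.

On the line, let `r` be a log-concave weight, let `x₀` be a point where `r` is at least half its
supremum, and let `J` be the interval {r > r(x₀)/e}. Take `S` to be the maximum of `g` on the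
closure of `J`. By Remez with ω = J, a point where g > S(4t)^d is so far away that the interval
spanned by it and `J` is longer than t|J|. Log-concavity makes the mass out there at most e·e^(-t)
of the total, and integration gives the Gamma factor (`upper_tail`). Conversely, Remez on each
superlevel interval K ⊇ J bounds {g < l} ∩ K by 4|K|(l/S)^(1/d). Summing over levels gives the
relative mass bound 8e(l/S)^(1/d), hence the factor 1/(1 - pd) (`small_ball`). Both moments are
collected in `exists_level_moments`.

The reduction is localization by bisection. If F^m and F^(-p) have averages `A` and `B` on `V`, then
F^m - A + η and F^(-p) - B + η both have positive integral. A halving hyperplane for the first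
function leaves the second with positive integral on one side. Hyperplanes through a dense set of
centres in every coordinate plane force the nested convex pieces towards a segment or a point
(`IsPositivePiece.exists_thin`). The process stops at a finite stage, when a piece is so thin that
`F` is nearly a function of one coordinate. The weight on the line is then the marginal of the
density on that piece, log-concave by Prékopa–Leindler.

Three limits finish the proof: η → 0, a regularization F + ε → F in the negative power, and d →
d_f(r), since the infimum defining the Chebyshev degree need not be attained. -/

/-! ### Brunn–Minkowski on the line and the Prékopa–Leindler inequality -/

theorem ENNReal.geom_mean_le_arith_mean2 {w : ℝ} (h0 : 0 < w) (h1 : w < 1) (a b : ℝ≥0∞) :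
    a ^ (1 - w) * b ^ w ≤ ENNReal.ofReal (1 - w) * a + ENNReal.ofReal w * b := by
  have h1' : 0 < 1 - w := by linarith
  by_cases ha : a = ∞
  · subst ha
    rw [ENNReal.mul_top (by simpa using h1)]
    simp
  by_cases hb : b = ∞
  · subst hb
    rw [ENNReal.mul_top (by simpa using h0)]
    simp
  lift a to NNReal using ha
  lift b to NNReal using hb
  have := NNReal.geom_mean_le_arith_mean2_weighted (Real.toNNReal (1 - w)) (Real.toNNReal w) a b
    (by rw [← Real.toNNReal_add h1'.le h0.le]; simp)
  rw [Real.coe_toNNReal _ h1'.le, Real.coe_toNNReal _ h0.le] at this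
  rw [← ENNReal.coe_rpow_of_nonneg _ h1'.le, ← ENNReal.coe_rpow_of_nonneg _ h0.le,
    ENNReal.ofReal, ENNReal.ofReal]
  exact_mod_cast this

/-- The Brunn–Minkowski inequality on the line. -/
theorem Real.volume_add_le_of_add_subset {A B C : Set ℝ} (hA : MeasurableSet A)
    (hB : MeasurableSet B) (hA' : A.Nonempty) (hB' : B.Nonempty)
    (h : ∀ x ∈ A, ∀ y ∈ B, x + y ∈ C) : volume A + volume B ≤ volume C := by
  have key : ∀ K ⊆ A, IsCompact K → K.Nonempty → ∀ L ⊆ B, IsCompact L → L.Nonempty →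
      volume K + volume L ≤ volume C := by
    intro K hK hKc hKn L hL hLc hLn
    obtain ⟨a, ha, hamax⟩ := hKc.exists_isGreatest hKn
    obtain ⟨b, hb, hbmin⟩ := hLc.exists_isLeast hLn
    have e1 : volume ((fun x => x + b) '' K) = volume K := by
      simp
    have e2 : volume ((fun x => a + x) '' L) = volume L := by
      simp
    -- With a = max K and b = min L, the translate K + b lies to the left of a + L, and they can
    -- meet only at a + b.
    have hd : AEDisjoint volume ((fun x => x + b) '' K) ((fun x => a + x) '' L) := by
      refine measure_mono_null (t := {a + b}) ?_ (by simp)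
      rintro _ ⟨⟨x, hx, rfl⟩, ⟨y, hy, hxy⟩⟩
      have h1 := hamax hx
      have h2 := hbmin hy
      simp only at hxy
      simp only [Set.mem_singleton_iff]
      linarith
    have hm : MeasurableSet ((fun x => a + x) '' L) :=
      (hLc.image (by fun_prop)).measurableSet
    rw [← e1, ← e2, ← measure_union₀ hm.nullMeasurableSet hd]
    refine measure_mono ?_
    rintro _ (⟨x, hx, rfl⟩ | ⟨y, hy, rfl⟩)
    · exact h x (hK hx) b (hL hb)
    · exact h a (hK ha) y (hL hy)
  obtain ⟨a, ha⟩ := hA'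
  obtain ⟨b, hb⟩ := hB'
  have : ∀ r < volume A, ∀ s < volume B, r + s ≤ volume C := by
    intro r hr s hs
    obtain ⟨K, hK, hKc, hrK⟩ := hA.exists_lt_isCompact hr
    obtain ⟨L, hL, hLc, hsL⟩ := hB.exists_lt_isCompact hs
    have := key (insert a K) (Set.insert_subset ha hK) (hKc.insert a) (Set.insert_nonempty _ _)
      (insert b L) (Set.insert_subset hb hL) (hLc.insert b) (Set.insert_nonempty _ _)
    refine le_trans (add_le_add ?_ ?_) this
    · exact hrK.le.trans (measure_mono (Set.subset_insert _ _))
    · exact hsL.le.trans (measure_mono (Set.subset_insert _ _))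
  -- A null set admits no r below its measure, so approximation from inside says nothing; a
  -- translate of the other set lies in `C`.
  by_cases hA0 : volume A = 0
  · rw [hA0, zero_add]
    rw [show volume B = volume ((fun x => a + x) '' B) by simp]
    refine measure_mono ?_
    rintro _ ⟨y, hy, rfl⟩
    exact h a ha y hy
  by_cases hB0 : volume B = 0
  · rw [hB0, add_zero]
    rw [show volume A = volume ((fun x => x + b) '' A) by simp]
    refine measure_mono ?_
    rintro _ ⟨y, hy, rfl⟩
    exact h y hy b hb
  have hs : ∀ s < volume B, volume A + s ≤ volume C := by
    intro s hs
    have h1 : volume A ≤ volume C - s :=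
      le_of_forall_lt_imp_le_of_dense fun r hr =>
        ENNReal.le_sub_of_add_le_right hs.ne_top (this r hr s hs)
    have h2 : s ≤ volume C := by simpa using this 0 (pos_iff_ne_zero.2 hA0) s hs
    exact (add_le_add_left h1 s).trans (tsub_add_cancel_of_le h2).le
  have hAC : volume A ≤ volume C := by simpa using hs 0 (pos_iff_ne_zero.2 hB0)
  by_cases hAt : volume A = ∞
  · rw [hAt, top_le_iff] at hAC
    simp [hAC]
  have h1 : volume B ≤ volume C - volume A :=
    le_of_forall_lt_imp_le_of_dense fun s h => ENNReal.le_sub_of_add_le_left hAt (hs s h)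
  calc _ ≤ volume A + (volume C - volume A) := by gcongr
    _ = _ := add_tsub_cancel_of_le hAC

/-- Layer cake plus Brunn–Minkowski at each level t. Both suprema equal one, so the superlevel sets
of `f` and `g` become empty at the same level; below it both are nonempty, as Brunn–Minkowski
requires. -/
theorem lintegral_add_le_of_superlevel {w : ℝ} (h0 : 0 < w) (h1 : w < 1) {f g h : ℝ → ℝ}
    (hf : Measurable f) (hg : Measurable g) (hh : Measurable h) (hf0 : ∀ x, 0 ≤ f x)
    (hg0 : ∀ x, 0 ≤ g x) (hh0 : ∀ x, 0 ≤ h x) (hf1 : ∀ x, f x ≤ 1) (hg1 : ∀ x, g x ≤ 1)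
    (hfs : ∀ t < 1, ∃ x, t < f x) (hgs : ∀ t < 1, ∃ x, t < g x)
    (H : ∀ t < 1, ∀ x y, t < f x → t < g y → t < h ((1 - w) * x + w * y)) :
    ENNReal.ofReal (1 - w) * (∫⁻ x, ENNReal.ofReal (f x)) +
      ENNReal.ofReal w * (∫⁻ x, ENNReal.ofReal (g x)) ≤ ∫⁻ x, ENNReal.ofReal (h x) := by
  have h1' : 0 < 1 - w := by linarith
  have lc : ∀ u : ℝ → ℝ, Measurable u → (∀ x, 0 ≤ u x) →
      ∫⁻ x, ENNReal.ofReal (u x) = ∫⁻ t in Set.Ioi 0, volume {a | t < u a} := fun u hu hu0 =>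
    lintegral_eq_lintegral_meas_lt volume (.of_forall hu0) hu.aemeasurable
  rw [lc f hf hf0, lc g hg hg0, lc h hh hh0]
  have mono : ∀ u : ℝ → ℝ, Measurable fun t => volume {a | t < u a} := fun u =>
    Antitone.measurable fun s t hst => measure_mono fun a ha => lt_of_le_of_lt hst ha
  rw [← lintegral_const_mul _ (mono f), ← lintegral_const_mul _ (mono g),
    ← lintegral_add_left ((mono f).const_mul _)]
  refine lintegral_mono fun t => ?_
  simp only
  rcases le_or_gt 1 t with ht | ht
  · have e1 : {a | t < f a} = ∅ := by
      ext a; simpa using (hf1 a).trans ht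
    have e2 : {a | t < g a} = ∅ := by
      ext a; simpa using (hg1 a).trans ht
    simp [e1, e2]
  have sc : ∀ c : ℝ, 0 < c → ∀ u : ℝ → ℝ, ENNReal.ofReal c * volume {a | t < u a} =
      volume ((fun x => c * x) '' {a | t < u a}) := by
    intro c hc u
    have := Measure.addHaar_smul (volume : Measure ℝ) c {a | t < u a}
    simp only [Module.finrank_self, pow_one, abs_of_pos hc] at this
    exact this.symm
  rw [sc _ h1', sc _ h0]
  have ms : ∀ c : ℝ, 0 < c → ∀ u : ℝ → ℝ, Measurable u →
      MeasurableSet ((fun x => c * x) '' {a | t < u a}) := by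
    intro c hc u hu
    exact (Homeomorph.mulLeft₀ c hc.ne').measurableEmbedding.measurableSet_image'
      (measurableSet_lt measurable_const hu)
  refine Real.volume_add_le_of_add_subset (ms _ h1' _ hf) (ms _ h0 _ hg) ?_ ?_ ?_
  · exact Set.Nonempty.image _ (hfs t ht)
  · exact Set.Nonempty.image _ (hgs t ht)
  · rintro _ ⟨x, hx, rfl⟩ _ ⟨y, hy, rfl⟩
    exact H t ht x y hx hy

theorem ENNReal.iSup_rpow_mul_iSup_rpow_le {u v : ℕ → ℝ≥0∞} (hu : Monotone u) (hv : Monotone v)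
    {a b : ℝ} (ha : 0 < a) (hb : 0 < b) {C : ℝ≥0∞} (H : ∀ n, u n ^ a * v n ^ b ≤ C) :
    (⨆ n, u n) ^ a * (⨆ n, v n) ^ b ≤ C := by
  have e1 : (⨆ n, u n) ^ a = ⨆ n, u n ^ a := (ENNReal.orderIsoRpow a ha).map_iSup u
  have e2 : (⨆ n, v n) ^ b = ⨆ n, v n ^ b := (ENNReal.orderIsoRpow b hb).map_iSup v
  rw [e1, e2, ENNReal.iSup_mul]
  refine iSup_le fun i => ?_
  rw [ENNReal.mul_iSup]
  refine iSup_le fun j => (le_trans ?_ (H (max i j)))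
  exact mul_le_mul' (ENNReal.rpow_le_rpow (hu (le_max_left _ _)) ha.le)
    (ENNReal.rpow_le_rpow (hv (le_max_right _ _)) hb.le)

/-- Dividing by the suprema makes the superlevel bound applicable, and the arithmetic-geometric mean
inequality turns its sum into a product. Truncating h / C at 1 keeps the values finite and costs
nothing, since only levels t < 1 matter. -/
theorem prekopa_leindler_real_of_bounded {w : ℝ} (h0 : 0 < w) (h1 : w < 1) {f g h : ℝ → ℝ≥0∞}
    (hf : Measurable f) (hg : Measurable g) (hh : Measurable h)
    (hfb : ⨆ x, f x ≠ ∞) (hgb : ⨆ x, g x ≠ ∞)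
    (H : ∀ x y, f x ^ (1 - w) * g y ^ w ≤ h ((1 - w) * x + w * y)) :
    (∫⁻ x, f x) ^ (1 - w) * (∫⁻ x, g x) ^ w ≤ ∫⁻ x, h x := by
  have h1' : 0 < 1 - w := by linarith
  set A := ⨆ x, f x with hA
  set B := ⨆ x, g x with hB
  have hfA : ∀ x, f x ≤ A := fun x => le_iSup f x
  have hgB : ∀ x, g x ≤ B := fun x => le_iSup g x
  by_cases hA0 : A = 0
  · have : ∀ x, f x = 0 := fun x => le_antisymm ((hfA x).trans hA0.le) bot_le
    simp [this, h1']
  by_cases hB0 : B = 0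
  · have : ∀ x, g x = 0 := fun x => le_antisymm ((hgB x).trans hB0.le) bot_le
    simp [this, h0]
  set C := A ^ (1 - w) * B ^ w with hC
  have hC0 : C ≠ 0 := by simp [hC, hA0, hB0, hfb, hgb]
  have hCt : C ≠ ∞ := ENNReal.mul_ne_top (by simp [hA0, hfb]) (by simp [hB0, hgb])
  have hle : ∀ x, min (h x / C) 1 ≠ ∞ := fun x => ne_top_of_le_ne_top (by simp) (min_le_right _ _)
  have hfd : ∀ x, f x / A ≤ 1 := fun x => ENNReal.div_le_of_le_mul (by simpa using hfA x)
  have hgd : ∀ x, g x / B ≤ 1 := fun x => ENNReal.div_le_of_le_mul (by simpa using hgB x)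
  have hft : ∀ x, f x / A ≠ ∞ := fun x => ne_top_of_le_ne_top (by simp) (hfd x)
  have hgt : ∀ x, g x / B ≠ ∞ := fun x => ne_top_of_le_ne_top (by simp) (hgd x)
  have sup1 : ∀ (u : ℝ → ℝ≥0∞) (D : ℝ≥0∞), D ≠ 0 → D ≠ ∞ → (⨆ x, u x) = D →
      (∀ x, u x / D ≠ ∞) → ∀ t < (1 : ℝ), ∃ x, t < (u x / D).toReal := by
    intro u D hD0 hDt hD hut t ht
    rcases lt_or_ge t 0 with h | h
    · exact ⟨0, h.trans_le ENNReal.toReal_nonneg⟩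
    have : ENNReal.ofReal t * D < ⨆ x, u x := by
      rw [hD]
      calc ENNReal.ofReal t * D < 1 * D :=
            ENNReal.mul_lt_mul_left hD0 hDt (by simpa using ht)
        _ = D := one_mul D
    obtain ⟨x, hx⟩ := lt_iSup_iff.1 this
    refine ⟨x, ?_⟩
    rw [← ENNReal.ofReal_lt_iff_lt_toReal h (hut x)]
    exact (ENNReal.lt_div_iff_mul_lt (Or.inl hD0) (Or.inl hDt)).2 hx
  have key := lintegral_add_le_of_superlevel h0 h1
    (f := fun x => (f x / A).toReal) (g := fun x => (g x / B).toReal)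
    (h := fun x => (min (h x / C) 1).toReal)
    (hf.div_const A).ennreal_toReal (hg.div_const B).ennreal_toReal
    ((hh.div_const C).min measurable_const).ennreal_toReal
    (fun _ => ENNReal.toReal_nonneg) (fun _ => ENNReal.toReal_nonneg)
    (fun _ => ENNReal.toReal_nonneg)
    (fun x => by simpa using ENNReal.toReal_mono (by simp) (hfd x))
    (fun x => by simpa using ENNReal.toReal_mono (by simp) (hgd x))
    (sup1 f A hA0 hfb rfl hft) (sup1 g B hB0 hgb rfl hgt) (by
      intro t ht x y hx hy
      rcases lt_or_ge t 0 with h | h'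
      · exact h.trans_le ENNReal.toReal_nonneg
      rw [← ENNReal.ofReal_lt_iff_lt_toReal h' (hft x)] at hx
      rw [← ENNReal.ofReal_lt_iff_lt_toReal h' (hgt y)] at hy
      rw [← ENNReal.ofReal_lt_iff_lt_toReal h' (hle _), lt_min_iff]
      refine ⟨?_, by simpa using ht⟩
      have e : (f x / A) ^ (1 - w) * (g y / B) ^ w = f x ^ (1 - w) * g y ^ w / C := by
        rw [ENNReal.div_rpow_of_nonneg _ _ h1'.le, ENNReal.div_rpow_of_nonneg _ _ h0.le, hC,
          div_eq_mul_inv, div_eq_mul_inv, div_eq_mul_inv, ENNReal.mul_inv (by simp [hA0, hfb])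
          (by simp [hA0, hfb])]
        ring
      have hlt : ENNReal.ofReal t < (f x / A) ^ (1 - w) * (g y / B) ^ w := by
        calc ENNReal.ofReal t = ENNReal.ofReal t ^ (1 - w) * ENNReal.ofReal t ^ w := by
              rw [← ENNReal.rpow_add_of_nonneg _ _ h1'.le h0.le]; simp
          _ < _ := ENNReal.mul_lt_mul (ENNReal.rpow_lt_rpow hx h1') (ENNReal.rpow_lt_rpow hy h0)
      refine hlt.trans_le ?_
      rw [e]
      exact ENNReal.div_le_div_right (H x y) C)
  simp only [ENNReal.ofReal_toReal (hft _), ENNReal.ofReal_toReal (hgt _),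
    ENNReal.ofReal_toReal (hle _)] at key
  have fA : ∫⁻ x, f x = A * ∫⁻ x, f x / A := by
    rw [← lintegral_const_mul _ (hf.div_const A)]
    simp_rw [ENNReal.mul_div_cancel hA0 hfb]
  have gB : ∫⁻ x, g x = B * ∫⁻ x, g x / B := by
    rw [← lintegral_const_mul _ (hg.div_const B)]
    simp_rw [ENNReal.mul_div_cancel hB0 hgb]
  calc (∫⁻ x, f x) ^ (1 - w) * (∫⁻ x, g x) ^ w
      = C * ((∫⁻ x, f x / A) ^ (1 - w) * (∫⁻ x, g x / B) ^ w) := by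
        rw [fA, gB, ENNReal.mul_rpow_of_nonneg _ _ h1'.le, ENNReal.mul_rpow_of_nonneg _ _ h0.le, hC]
        ring
    _ ≤ C * ∫⁻ x, min (h x / C) 1 := by
        gcongr
        exact (ENNReal.geom_mean_le_arith_mean2 h0 h1 _ _).trans key
    _ ≤ C * ∫⁻ x, h x / C := by
        gcongr with x
        exact min_le_left _ _
    _ = ∫⁻ x, h x := by
        rw [← lintegral_const_mul _ (hh.div_const C)]
        simp_rw [ENNReal.mul_div_cancel hC0 hCt]

/-- The Prékopa–Leindler inequality on the line. -/
theorem prekopa_leindler_real {w : ℝ} (h0 : 0 < w) (h1 : w < 1) {f g h : ℝ → ℝ≥0∞}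
    (hf : Measurable f) (hg : Measurable g) (hh : Measurable h)
    (H : ∀ x y, f x ^ (1 - w) * g y ^ w ≤ h ((1 - w) * x + w * y)) :
    (∫⁻ x, f x) ^ (1 - w) * (∫⁻ x, g x) ^ w ≤ ∫⁻ x, h x := by
  have h1' : 0 < 1 - w := by linarith
  have trunc : ∀ u : ℝ → ℝ≥0∞, Measurable u →
      ∫⁻ x, u x = ⨆ n : ℕ, ∫⁻ x, min (u x) n := by
    intro u hu
    rw [← lintegral_iSup (fun n => hu.min measurable_const)
      (fun i j hij x => min_le_min_left _ (by exact_mod_cast hij))]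
    refine lintegral_congr fun x => ?_
    rw [← inf_iSup_eq, ENNReal.iSup_natCast, inf_top_eq]
  have mono : ∀ u : ℝ → ℝ≥0∞, Monotone fun n : ℕ => ∫⁻ x, min (u x) n := fun u i j hij =>
    lintegral_mono fun x => min_le_min_left _ (by exact_mod_cast hij)
  rw [trunc f hf, trunc g hg]
  refine ENNReal.iSup_rpow_mul_iSup_rpow_le (mono f) (mono g) h1' h0 fun n => ?_
  refine prekopa_leindler_real_of_bounded h0 h1 (hf.min measurable_const)
    (hg.min measurable_const) hh ?_ ?_ fun x y => le_trans ?_ (H x y)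
  · exact ne_top_of_le_ne_top (ENNReal.natCast_ne_top n) (iSup_le fun x => min_le_right _ _)
  · exact ne_top_of_le_ne_top (ENNReal.natCast_ne_top n) (iSup_le fun x => min_le_right _ _)
  · exact mul_le_mul' (ENNReal.rpow_le_rpow (min_le_left _ _) h1'.le)
      (ENNReal.rpow_le_rpow (min_le_left _ _) h0.le)

theorem lintegral_fin_succ_eq {k : ℕ} (i : Fin (k + 1)) {f : (Fin (k + 1) → ℝ) → ℝ≥0∞}
    (hf : Measurable f) :
    ∫⁻ x, f x = ∫⁻ s : ℝ, ∫⁻ z : Fin k → ℝ, f (i.insertNth s z) := by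
  have e := (volume_preserving_piFinSuccAbove (fun _ : Fin (k + 1) => ℝ) i).symm
  rw [← e.lintegral_comp hf]
  exact lintegral_prod _ (hf.comp e.measurable).aemeasurable

theorem measurable_insertNth_uncurry {k : ℕ} (i : Fin (k + 1)) :
    Measurable fun p : ℝ × (Fin k → ℝ) => (i.insertNth p.1 p.2 : Fin (k + 1) → ℝ) :=
  (MeasurableEquiv.piFinSuccAbove (fun _ : Fin (k + 1) => ℝ) i).symm.measurable

theorem insertNth_convex_comb {k : ℕ} (i : Fin (k + 1)) (a b s t : ℝ) (x y : Fin k → ℝ) :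
    (i.insertNth (a * s + b * t) (a • x + b • y) : Fin (k + 1) → ℝ) =
      a • (i.insertNth s x : Fin (k + 1) → ℝ) + b • (i.insertNth t y : Fin (k + 1) → ℝ) := by
  ext j
  refine i.succAboveCases ?_ (fun j => ?_) j <;> simp

/-- The Prékopa–Leindler inequality. -/
theorem prekopa_leindler {w : ℝ} (h0 : 0 < w) (h1 : w < 1) (k : ℕ) :
    ∀ {f g h : (Fin k → ℝ) → ℝ≥0∞}, Measurable f → Measurable g → Measurable h →
    (∀ x y, f x ^ (1 - w) * g y ^ w ≤ h ((1 - w) • x + w • y)) →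
    (∫⁻ x, f x) ^ (1 - w) * (∫⁻ x, g x) ^ w ≤ ∫⁻ x, h x := by
  induction k with
  | zero =>
    intro f g h hf hg hh H
    have := H default default
    rw [volume_pi, Measure.pi_of_empty]
    simp only [lintegral_dirac]
    convert this
  | succ k ih =>
    intro f g h hf hg hh H
    have hm := measurable_insertNth_uncurry (0 : Fin (k + 1))
    rw [lintegral_fin_succ_eq 0 hf, lintegral_fin_succ_eq 0 hg, lintegral_fin_succ_eq 0 hh]
    have ms : ∀ {u : (Fin (k + 1) → ℝ) → ℝ≥0∞} (s : ℝ), Measurable u →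
        Measurable fun z : Fin k → ℝ => u ((0 : Fin (k + 1)).insertNth s z) := fun s hu =>
      hu.comp (hm.comp (measurable_const.prodMk measurable_id))
    -- The fibre integrals satisfy the one-dimensional hypothesis, by induction applied to the
    -- slices at heights s and t.
    refine prekopa_leindler_real h0 h1 (hf.comp hm).lintegral_prod_right'
      (hg.comp hm).lintegral_prod_right' (hh.comp hm).lintegral_prod_right' fun s t => ?_
    refine ih (ms s hf) (ms t hg) (ms _ hh) fun x y => ?_
    rw [insertNth_convex_comb]
    exact H _ _

/-- Marginals of log-concave densities are log-concave. -/
theorem lintegral_insertNth_logConcave {k : ℕ} (i : Fin (k + 1))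
    {h : (Fin (k + 1) → ℝ) → ℝ≥0∞} (hh : Measurable h) {w : ℝ} (h0 : 0 < w) (h1 : w < 1)
    (H : ∀ x y, h x ^ (1 - w) * h y ^ w ≤ h ((1 - w) • x + w • y)) (s t : ℝ) :
    (∫⁻ z : Fin k → ℝ, h (i.insertNth s z)) ^ (1 - w) *
        (∫⁻ z : Fin k → ℝ, h (i.insertNth t z)) ^ w ≤
      ∫⁻ z : Fin k → ℝ, h (i.insertNth ((1 - w) * s + w * t) z) := by
  have ms : ∀ s : ℝ, Measurable fun z : Fin k → ℝ => h (i.insertNth s z) := fun s =>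
    hh.comp ((measurable_insertNth_uncurry i).comp (measurable_const.prodMk measurable_id))
  refine prekopa_leindler h0 h1 k (ms s) (ms t) (ms _) fun x y => ?_
  rw [insertNth_convex_comb]
  exact H _ _

/-! ### Tails of log-concave weights on the line -/

/-- Multiplicative log-concavity of a function on the line. -/
def LogConcaveOnLine (r : ℝ → ℝ) : Prop :=
  ∀ w : ℝ, 0 < w → w < 1 → ∀ x y, r x ^ (1 - w) * r y ^ w ≤ r ((1 - w) * x + w * y)

/-- A Remez inequality with exponent `d` on all subintervals of `[α, β]`. -/
def RemezOnInterval (g : ℝ → ℝ) (d α β : ℝ) : Prop :=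
  ∀ c e, α ≤ c → c < e → e ≤ β → ∀ ω ⊆ Set.Icc c e, MeasurableSet ω → volume ω ≠ 0 →
    ∀ L, (∀ z ∈ ω, g z ≤ L) → ∀ x ∈ Set.Icc c e, g x ≤ (4 * (e - c) / (volume ω).toReal) ^ d * L

theorem LogConcaveOnLine.ordConnected_superlevel {r : ℝ → ℝ} (hr : LogConcaveOnLine r) {t : ℝ}
    (ht : 0 ≤ t) : Set.OrdConnected {x | t < r x} := by
  refine Convex.ordConnected ?_
  refine convex_iff_forall_pos.2 fun x hx y hy a b ha hb hab => ?_
  have h := hr b hb (by linarith) x y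
  rw [show 1 - b = a by linarith] at h
  have : t < r x ^ a * r y ^ b := by
    calc t = t ^ a * t ^ b := by
          rw [← Real.rpow_add_of_nonneg ht ha.le hb.le, hab, Real.rpow_one]
      _ < r x ^ a * r y ^ b :=
        mul_lt_mul'' (Real.rpow_lt_rpow ht hx ha) (Real.rpow_lt_rpow ht hy hb)
          (Real.rpow_nonneg ht _) (Real.rpow_nonneg ht _)
  exact this.trans_le h

theorem LogConcaveOnLine.comp_neg {r : ℝ → ℝ} (hr : LogConcaveOnLine r) :
    LogConcaveOnLine fun x => r (-x) := by
  intro w h0 h1 x y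
  have := hr w h0 h1 (-x) (-y)
  convert this using 2
  ring

theorem volume_of_ordConnected {K : Set ℝ} (hK : K.OrdConnected) (hne : K.Nonempty)
    (hb : BddBelow K) (ha : BddAbove K) : volume K = ENNReal.ofReal (sSup K - sInf K) := by
  refine le_antisymm ?_ ?_
  · rw [← Real.volume_Icc]
    exact measure_mono fun x hx => ⟨csInf_le hb hx, le_csSup ha hx⟩
  · rw [← Real.volume_Ioo]
    exact measure_mono (IsConnected.Ioo_csInf_csSup_subset ⟨hne, hK.isPreconnected⟩ hb ha)

/-- Beyond `x₀ + b`, where the density has dropped by a factor `e`, it decays exponentially. -/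
theorem LogConcaveOnLine.le_exp {r : ℝ → ℝ} (hr : LogConcaveOnLine r) (hr0 : ∀ x, 0 ≤ r x)
    {x₀ b : ℝ} (hx₀ : 0 < r x₀) (hb : ∀ y, x₀ + b < y → r y ≤ r x₀ / Real.exp 1)
    {x c : ℝ} (hc : b < c) (hc0 : 0 < c) (hx : x₀ + c < x) :
    r x ≤ r x₀ * Real.exp (-((x - x₀) / c)) := by
  have hxx : 0 < x - x₀ := by linarith
  -- The weight `w` places x₀ + c between `x₀` and x. There `log r` has dropped by at least 1, so by
  -- concavity its mean slope from `x₀` to x is at most -1/c.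
  set w := c / (x - x₀) with hw
  have hw0 : 0 < w := div_pos hc0 hxx
  have hw1 : w < 1 := (div_lt_one hxx).2 (by linarith)
  have h1 := hr w hw0 hw1 x₀ x
  have e1 : (1 - w) * x₀ + w * x = x₀ + c := by
    have : w * (x - x₀) = c := div_mul_cancel₀ _ hxx.ne'
    linarith
  rw [e1] at h1
  have h2 := h1.trans (hb _ (by linarith))
  have h3 : (r x / r x₀) ^ w ≤ Real.exp (-1) := by
    rw [Real.div_rpow (hr0 x) hx₀.le, div_le_iff₀ (Real.rpow_pos_of_pos hx₀ _), Real.exp_neg]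
    rw [Real.rpow_sub hx₀, Real.rpow_one, div_mul_eq_mul_div,
      div_le_iff₀ (Real.rpow_pos_of_pos hx₀ _)] at h2
    refine le_of_mul_le_mul_left ?_ hx₀
    calc _ ≤ _ := h2
      _ = _ := by ring
  have h4 : r x / r x₀ ≤ Real.exp (-1) ^ (1 / w) := by
    have := Real.rpow_le_rpow (Real.rpow_nonneg (div_nonneg (hr0 x) hx₀.le) _) h3
      (one_div_pos.2 hw0).le
    rwa [← Real.rpow_mul (div_nonneg (hr0 x) hx₀.le), mul_one_div_cancel hw0.ne',
      Real.rpow_one] at this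
  rw [div_le_iff₀ hx₀, ← Real.exp_mul] at h4
  refine h4.trans_eq ?_
  rw [mul_comm, hw]
  congr 2
  field_simp

theorem lintegral_exp_tail {x₀ b t M : ℝ} (hb : 0 < b) (hM : 0 ≤ M) :
    ∫⁻ x in Set.Ioi (x₀ + t * b), ENNReal.ofReal (M * Real.exp (-((x - x₀) / b))) =
      ENNReal.ofReal (M * b * Real.exp (-t)) := by
  have e : ∀ x, M * Real.exp (-((x - x₀) / b)) =
      M * Real.exp (x₀ / b) * Real.exp (-b⁻¹ * x) := by
    intro x
    rw [mul_assoc, ← Real.exp_add]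
    congr 2
    field_simp
    ring
  have hb' : 0 < b⁻¹ := inv_pos.2 hb
  simp_rw [e]
  rw [← ofReal_integral_eq_lintegral_ofReal]
  · rw [integral_const_mul, integral_exp_mul_Ioi (by linarith)]
    congr 1
    rw [show -b⁻¹ * (x₀ + t * b) = -t - x₀ / b by field_simp; ring, Real.exp_sub]
    field_simp
  · exact ((exp_neg_integrableOn_Ioi _ hb').const_mul _)
  · exact .of_forall fun x => by positivity

/-- The exponential bound holds for every c > b; letting c decrease to b gives rate 1/b, which
integrates to the claim. When b = 0 the same limit shows that `r` vanishes on the tail. -/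
theorem LogConcaveOnLine.lintegral_Ioi_le {r : ℝ → ℝ} (hr : LogConcaveOnLine r)
    (hr0 : ∀ x, 0 ≤ r x) {x₀ b t : ℝ} (hx₀ : 0 < r x₀) (hb0 : 0 ≤ b)
    (hb : ∀ y, x₀ + b < y → r y ≤ r x₀ / Real.exp 1) (ht : 1 ≤ t) :
    ∫⁻ x in Set.Ioi (x₀ + t * b), ENNReal.ofReal (r x) ≤
      ENNReal.ofReal (r x₀ * b * Real.exp (-t)) := by
  have hlim : ∀ x, x₀ + b < x → ∀ᶠ c in nhdsWithin b (Set.Ioi b),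
      r x ≤ r x₀ * Real.exp (-((x - x₀) / c)) := by
    intro x hx
    filter_upwards [Ioo_mem_nhdsGT (show b < x - x₀ by linarith)] with c hc
    exact hr.le_exp hr0 hx₀ hb hc.1 (hb0.trans_lt hc.1) (by linarith [hc.2])
  have hsub : ∀ x ∈ Set.Ioi (x₀ + t * b), x₀ + b < x := by
    intro x hx
    have : 1 * b ≤ t * b := mul_le_mul_of_nonneg_right ht hb0
    have hx' : x₀ + t * b < x := hx
    linarith
  rcases hb0.eq_or_lt with h0 | h0
  · have hz : ∀ x ∈ Set.Ioi (x₀ + t * b), ENNReal.ofReal (r x) = 0 := by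
      intro x hx
      have hx' := hsub x hx
      rw [ENNReal.ofReal_eq_zero]
      have T : Filter.Tendsto (fun c => r x₀ * Real.exp (-((x - x₀) / c)))
          (nhdsWithin b (Set.Ioi b)) (nhds (r x₀ * 0)) := by
        refine Filter.Tendsto.const_mul _ ?_
        subst h0
        have hp : 0 < x - x₀ := by linarith
        have T' : Filter.Tendsto (fun c => (x - x₀) * c⁻¹) (nhdsWithin (0 : ℝ) (Set.Ioi 0))
            Filter.atTop := tendsto_inv_nhdsGT_zero.const_mul_atTop hp
        exact Real.tendsto_exp_neg_atTop_nhds_zero.comp T'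
      rw [mul_zero] at T
      exact ge_of_tendsto T (hlim x hx')
    rw [setLIntegral_congr_fun measurableSet_Ioi hz]
    simp
  · rw [← lintegral_exp_tail h0 hx₀.le]
    refine setLIntegral_mono' measurableSet_Ioi fun x hx => ENNReal.ofReal_le_ofReal ?_
    have T : Filter.Tendsto (fun c => r x₀ * Real.exp (-((x - x₀) / c)))
        (nhdsWithin b (Set.Ioi b)) (nhds (r x₀ * Real.exp (-((x - x₀) / b)))) := by
      refine Filter.Tendsto.mono_left ?_ nhdsWithin_le_nhds
      have : ContinuousAt (fun c => r x₀ * Real.exp (-((x - x₀) / c))) b := by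
        fun_prop (disch := exact h0.ne')
      exact this
    exact ge_of_tendsto T (hlim x (hsub x hx))

theorem LogConcaveOnLine.lintegral_Iio_le {r : ℝ → ℝ} (hr : LogConcaveOnLine r)
    (hr0 : ∀ x, 0 ≤ r x) {x₀ b t : ℝ} (hx₀ : 0 < r x₀) (hb0 : 0 ≤ b)
    (hb : ∀ y, y < x₀ - b → r y ≤ r x₀ / Real.exp 1) (ht : 1 ≤ t) :
    ∫⁻ x in Set.Iio (x₀ - t * b), ENNReal.ofReal (r x) ≤
      ENNReal.ofReal (r x₀ * b * Real.exp (-t)) := by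
  have := hr.comp_neg.lintegral_Ioi_le (fun x => hr0 _) (x₀ := -x₀) (by simpa using hx₀) hb0
    (fun y hy => by simpa using hb (-y) (by linarith)) ht
  simp only [neg_neg] at this
  refine le_trans (le_of_eq ?_) this
  rw [← (Measure.measurePreserving_neg (volume : Measure ℝ)).setLIntegral_comp_preimage_emb
    (MeasurableEquiv.neg ℝ).measurableEmbedding]
  congr 2
  ext x
  simp only [Set.mem_preimage, Set.mem_Iio, Set.mem_Ioi]
  constructor <;> intro h <;> linarith

/-- The supremum of a log-concave weight need not be attained; a point with half of it suffices, at
the price of a factor 2 in the small-value estimate. -/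
theorem exists_half_sup {r : ℝ → ℝ} (hb : BddAbove (Set.range r)) (hpos : ∃ x, 0 < r x) :
    ∃ x₀, 0 < r x₀ ∧ ∀ x, r x ≤ 2 * r x₀ := by
  obtain ⟨x, hx⟩ := hpos
  have h1 : r x ≤ ⨆ y, r y := le_ciSup hb x
  obtain ⟨x₀, h0⟩ := exists_lt_of_lt_ciSup (show (⨆ y, r y) / 2 < ⨆ y, r y by linarith)
  exact ⟨x₀, by linarith, fun y => by linarith [le_ciSup hb y]⟩

/-- Ensures that the central interval `J` is nondegenerate: on the way from `x₀` to `x₁` the weight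
is at least r(x₀)^(1-w) r(x₁)^w, which tends to r(x₀) as w → 0. -/
theorem LogConcaveOnLine.exists_ne_superlevel {r : ℝ → ℝ} (hr : LogConcaveOnLine r) {x₀ x₁ : ℝ}
    (h0 : 0 < r x₀) (h1 : 0 < r x₁) (hne : x₁ ≠ x₀) {t : ℝ} (ht : t < r x₀) :
    ∃ y ≠ x₀, t < r y := by
  have T : Filter.Tendsto (fun w : ℝ => r x₀ ^ (1 - w) * r x₁ ^ w)
      (nhdsWithin 0 (Set.Ioi 0)) (nhds (r x₀)) := by
    refine Filter.Tendsto.mono_left ?_ nhdsWithin_le_nhds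
    have : ContinuousAt (fun w : ℝ => r x₀ ^ (1 - w) * r x₁ ^ w) 0 := by
      refine ContinuousAt.mul ?_ ?_
      · exact ContinuousAt.rpow continuousAt_const (by fun_prop) (Or.inl h0.ne')
      · exact ContinuousAt.rpow continuousAt_const (by fun_prop) (Or.inl h1.ne')
    simpa [ContinuousAt] using this
  obtain ⟨w, hw, hw'⟩ := ((T.eventually (lt_mem_nhds ht)).and
    (Ioo_mem_nhdsGT (zero_lt_one' ℝ))).exists
  refine ⟨(1 - w) * x₀ + w * x₁, ?_, hw.trans_le (hr w hw'.1 hw'.2 x₀ x₁)⟩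
  intro h
  have : w * (x₁ - x₀) = 0 := by linarith
  rcases mul_eq_zero.1 this with h | h
  · exact hw'.1.ne' h
  · exact hne (by linarith)

/-! ### Small and large values of a Remez function under a log-concave weight -/

/-- This is the Remez inequality for the sublevel set, solved for the length of ω. -/
theorem RemezOnInterval.volume_sublevel_le {g : ℝ → ℝ} {d α β : ℝ} (hR : RemezOnInterval g d α β)
    (hd : 0 < d) (hg : Measurable g) {c e xs l : ℝ} (hc : α ≤ c) (hce : c < e)
    (he : e ≤ β) (hxs : xs ∈ Set.Icc c e) (hS : 0 < g xs) (hl : 0 < l) :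
    volume ({x | g x < l} ∩ Set.Icc c e) ≤ ENNReal.ofReal (4 * (e - c) * (l / g xs) ^ (1 / d)) := by
  set ω := {x | g x < l} ∩ Set.Icc c e with hω
  by_cases h0 : volume ω = 0
  · simp [h0]
  have hfin : volume ω ≠ ∞ :=
    ne_top_of_le_ne_top (by simp) (measure_mono (Set.inter_subset_right : ω ⊆ Set.Icc c e))
  have hpos : 0 < (volume ω).toReal := ENNReal.toReal_pos h0 hfin
  have h := hR c e hc hce he ω Set.inter_subset_right
    ((measurableSet_lt hg measurable_const).inter measurableSet_Icc) h0 l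
    (fun z hz => (show g z < l from hz.1).le) xs hxs
  rw [ENNReal.le_ofReal_iff_toReal_le hfin
    (by have : 0 < e - c := by linarith
        positivity)]
  have hQ : 0 < 4 * (e - c) / (volume ω).toReal := by
    have : 0 < e - c := by linarith
    positivity
  have h2 : (g xs / l) ^ (1 / d) ≤ 4 * (e - c) / (volume ω).toReal := by
    have h3 : g xs / l ≤ (4 * (e - c) / (volume ω).toReal) ^ d := (div_le_iff₀ hl).2 h
    have h4 := Real.rpow_le_rpow (by positivity) h3 (one_div_pos.2 hd).le
    rwa [← Real.rpow_mul hQ.le, mul_one_div_cancel hd.ne', Real.rpow_one] at h4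
  rw [show l / g xs = (g xs / l)⁻¹ by rw [inv_div], Real.inv_rpow (by positivity)]
  rw [le_div_iff₀ hpos] at h2
  have h5 : 0 < (g xs / l) ^ (1 / d) := by positivity
  rw [← div_eq_mul_inv, le_div_iff₀ h5]
  linarith

theorem lintegral_ofReal_eq_superlevel (μ : Measure ℝ) {r : ℝ → ℝ} (hr : Measurable r)
    (hr0 : ∀ x, 0 ≤ r x) :
    ∫⁻ x, ENNReal.ofReal (r x) ∂μ = ∫⁻ t in Set.Ioi 0, μ {x | t < r x} :=
  lintegral_eq_lintegral_meas_lt μ (.of_forall hr0) hr.aemeasurable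

theorem superlevel_subset_Icc {r : ℝ → ℝ} {α β t : ℝ} (hsupp : ∀ x, x ∉ Set.Icc α β → r x = 0)
    (ht : 0 ≤ t) : {x | t < r x} ⊆ Set.Icc α β := by
  intro x hx
  by_contra h
  rw [Set.mem_ofPred_eq, hsupp x h] at hx
  linarith

/-- The weight is truncated at τ = r(x₀)/e, so that only superlevel intervals containing `J` enter
the layer cake. Each of them contains `xs` in its closure, and Remez there bounds the fraction on
which g < l. The constant 8e is the Remez factor 4 times the truncation loss 2e. -/
theorem small_ball {r g : ℝ → ℝ} {d α β x₀ xs l : ℝ} (hr : LogConcaveOnLine r)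
    (hr0 : ∀ x, 0 ≤ r x) (hrm : Measurable r) (hsupp : ∀ x, x ∉ Set.Icc α β → r x = 0)
    (hg : Measurable g) (hd : 0 < d) (hR : RemezOnInterval g d α β) (hx₀ : 0 < r x₀)
    (hx₀2 : ∀ x, r x ≤ 2 * r x₀)
    (hJ : sInf {x | r x₀ / Real.exp 1 < r x} < sSup {x | r x₀ / Real.exp 1 < r x})
    (hxs : xs ∈ Set.Icc (sInf {x | r x₀ / Real.exp 1 < r x}) (sSup {x | r x₀ / Real.exp 1 < r x}))
    (hS : 0 < g xs) (hl : 0 < l) :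
    ∫⁻ x in {x | g x < l}, ENNReal.ofReal (r x) ≤
      ENNReal.ofReal (8 * Real.exp 1 * (l / g xs) ^ (1 / d)) * ∫⁻ x, ENNReal.ofReal (r x) := by
  set τ := r x₀ / Real.exp 1 with hτ
  have hτ0 : 0 < τ := by positivity
  set κ := (l / g xs) ^ (1 / d) with hκ
  have hκ0 : 0 < κ := by positivity
  set D := {x | g x < l} with hD
  have hDm : MeasurableSet D := measurableSet_lt hg measurable_const
  have hMτ : r x₀ = Real.exp 1 * τ := by rw [hτ]; field_simp
  -- Where `r` exceeds τ it is still at most 2 r(x₀) = 2eτ.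
  have hbd : ∀ x, r x ≤ 2 * Real.exp 1 * min (r x) τ := by
    intro x
    have he : 1 ≤ Real.exp 1 := Real.one_le_exp zero_le_one
    rcases min_cases (r x) τ with h | h
    · rw [h.1]; nlinarith [hr0 x]
    · rw [h.1]; nlinarith [hx₀2 x]
  have lev : ∀ t : ℝ, 0 < t → (volume.restrict D) {x | t < min (r x) τ} ≤
      ENNReal.ofReal (4 * κ) * volume {x | t < r x} := by
    intro t ht
    rw [Measure.restrict_apply (measurableSet_lt measurable_const (hrm.min measurable_const))]
    rcases le_or_gt τ t with h | h
    · have : {x | t < min (r x) τ} = ∅ := by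
        ext x; simp [h]
      rw [this]
      simp
    set K := {x | t < r x} with hK
    have hJK : {x | τ < r x} ⊆ K := fun x hx => h.trans hx
    have hKI : K ⊆ Set.Icc α β := superlevel_subset_Icc hsupp ht.le
    have hKb : BddBelow K := bddBelow_Icc.mono hKI
    have hKa : BddAbove K := bddAbove_Icc.mono hKI
    have hJne : {x | τ < r x}.Nonempty :=
      ⟨x₀, by
        rw [Set.mem_ofPred_eq, hτ]
        exact div_lt_self hx₀ (Real.one_lt_exp_iff.2 zero_lt_one)⟩
    have hKne : K.Nonempty := hJne.mono hJK
    have i1 : sInf K ≤ sInf {x | τ < r x} := csInf_le_csInf hKb hJne hJK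
    have i2 : sSup {x | τ < r x} ≤ sSup K := csSup_le_csSup hKa hJne hJK
    rw [volume_of_ordConnected (hr.ordConnected_superlevel ht.le) hKne hKb hKa,
      ← ENNReal.ofReal_mul (by positivity)]
    have hlt : sInf K < sSup K := i1.trans_lt (hJ.trans_le i2)
    have := hR.volume_sublevel_le hd hg (c := sInf K) (e := sSup K) (xs := xs)
      (le_csInf hKne fun x hx => (hKI hx).1) hlt
      (csSup_le hKne fun x hx => (hKI hx).2) ⟨i1.trans hxs.1, hxs.2.trans i2⟩ hS hl
    calc volume ({x | t < min (r x) τ} ∩ D) ≤ volume (D ∩ Set.Icc (sInf K) (sSup K)) := by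
          refine measure_mono fun x hx => ⟨hx.2, ?_⟩
          have hx1 : t < min (r x) τ := hx.1
          have hxK : x ∈ K := (lt_min_iff.1 hx1).1
          exact ⟨csInf_le hKb hxK, le_csSup hKa hxK⟩
      _ ≤ _ := this
      _ = _ := by congr 1; ring
  calc ∫⁻ x in D, ENNReal.ofReal (r x)
      ≤ ∫⁻ x in D, ENNReal.ofReal (2 * Real.exp 1) * ENNReal.ofReal (min (r x) τ) := by
        refine lintegral_mono fun x => ?_
        rw [← ENNReal.ofReal_mul (by positivity)]
        exact ENNReal.ofReal_le_ofReal (hbd x)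
    _ = ENNReal.ofReal (2 * Real.exp 1) * ∫⁻ x in D, ENNReal.ofReal (min (r x) τ) :=
        lintegral_const_mul _ (hrm.min measurable_const).ennreal_ofReal
    _ ≤ ENNReal.ofReal (2 * Real.exp 1) *
        (ENNReal.ofReal (4 * κ) * ∫⁻ x, ENNReal.ofReal (r x)) := by
        gcongr
        rw [lintegral_ofReal_eq_superlevel _ (hrm.min measurable_const)
            (fun x => le_min (hr0 x) hτ0.le),
          lintegral_ofReal_eq_superlevel _ hrm hr0, ← lintegral_const_mul' _ _ ENNReal.ofReal_ne_top]
        exact setLIntegral_mono' measurableSet_Ioi fun t ht => lev t ht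
    _ = _ := by
        rw [← mul_assoc, ← ENNReal.ofReal_mul (by positivity)]
        congr 2
        ring

/-- Remez on the interval joining x to `J`, with ω the closure of `J`, turns a large value at x into
a large distance. Beyond `J` the weight decays exponentially on each side at a rate set by the
distance from `x₀` to that end of `J`. The two tails add up to e·e^(-t)·τ|J|, and τ|J| is at most
the total mass. For t < 1 the bound is trivial. -/
theorem upper_tail {r g : ℝ → ℝ} {d α β x₀ xs t : ℝ} (hr : LogConcaveOnLine r)
    (hr0 : ∀ x, 0 ≤ r x) (hsupp : ∀ x, x ∉ Set.Icc α β → r x = 0)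
    (hd : 0 < d) (hR : RemezOnInterval g d α β) (hx₀ : 0 < r x₀)
    (hJ : sInf {x | r x₀ / Real.exp 1 < r x} < sSup {x | r x₀ / Real.exp 1 < r x})
    (hxs : ∀ x ∈ Set.Icc (sInf {x | r x₀ / Real.exp 1 < r x})
      (sSup {x | r x₀ / Real.exp 1 < r x}), g x ≤ g xs)
    (hS : 0 < g xs) (ht : 0 < t) :
    ∫⁻ x in {x | g xs * (4 * t) ^ d < g x}, ENNReal.ofReal (r x) ≤
      ENNReal.ofReal (Real.exp 1 * Real.exp (-t)) * ∫⁻ x, ENNReal.ofReal (r x) := by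
  rcases lt_or_ge t 1 with ht1 | ht1
  · have h1 : (1 : ℝ≥0∞) ≤ ENNReal.ofReal (Real.exp 1 * Real.exp (-t)) := by
      rw [← ENNReal.ofReal_one]
      refine ENNReal.ofReal_le_ofReal ?_
      rw [← Real.exp_add]
      exact Real.one_le_exp (by linarith)
    calc _ ≤ ∫⁻ x, ENNReal.ofReal (r x) := setLIntegral_le_lintegral _ _
      _ = 1 * ∫⁻ x, ENNReal.ofReal (r x) := (one_mul _).symm
      _ ≤ _ := by gcongr
  set τ := r x₀ / Real.exp 1 with hτ
  have hτ0 : 0 < τ := by positivity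
  have hMτ : r x₀ = Real.exp 1 * τ := by rw [hτ]; field_simp
  set J := {x | τ < r x} with hJd
  have hJI : J ⊆ Set.Icc α β := superlevel_subset_Icc hsupp hτ0.le
  have hJb : BddBelow J := bddBelow_Icc.mono hJI
  have hJa : BddAbove J := bddAbove_Icc.mono hJI
  have hx₀J : x₀ ∈ J := div_lt_self hx₀ (Real.one_lt_exp_iff.2 zero_lt_one)
  have hJne : J.Nonempty := ⟨x₀, hx₀J⟩
  have k1 : sInf J ≤ x₀ := csInf_le hJb hx₀J
  have k2 : x₀ ≤ sSup J := le_csSup hJa hx₀J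
  have hα : α ≤ sInf J := le_csInf hJne fun x hx => (hJI hx).1
  have hβ : sSup J ≤ β := csSup_le hJne fun x hx => (hJI hx).2
  have vol : (volume (Set.Icc (sInf J) (sSup J))).toReal = sSup J - sInf J := by
    rw [Real.volume_Icc, ENNReal.toReal_ofReal (by linarith)]
  have vol0 : volume (Set.Icc (sInf J) (sSup J)) ≠ 0 := by
    rw [Real.volume_Icc]; simpa using hJ
  have hℓ : 0 < sSup J - sInf J := by linarith
  have far : ∀ x ∈ Set.Icc α β, g xs * (4 * t) ^ d < g x → ∀ c e, α ≤ c → e ≤ β →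
      c ≤ sInf J → sSup J ≤ e → x ∈ Set.Icc c e → t * (sSup J - sInf J) < e - c := by
    intro x hx hgx c e hc he hcJ hJe hxce
    have h := hR c e hc (by linarith) he (Set.Icc (sInf J) (sSup J))
      (Set.Icc_subset_Icc hcJ hJe) measurableSet_Icc vol0 (g xs) hxs x hxce
    rw [vol] at h
    have h2 : (4 * t) ^ d < (4 * (e - c) / (sSup J - sInf J)) ^ d := by
      have h3 := hgx.trans_le h
      rw [mul_comm] at h3
      exact lt_of_mul_lt_mul_right h3 hS.le
    have h3 := (Real.rpow_lt_rpow_iff (by positivity)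
      (div_nonneg (by linarith) hℓ.le) hd).1 h2
    rw [lt_div_iff₀ hℓ] at h3
    linarith
  -- To the right of `J`, Remez gives x > inf J + t|J|, which is at least x₀ + t(sup J - x₀) because
  -- t ≥ 1; the left side is symmetric.
  have sub : {x | g xs * (4 * t) ^ d < g x} ⊆ (Set.Ioi (x₀ + t * (sSup J - x₀)) ∪
      Set.Iio (x₀ - t * (x₀ - sInf J))) ∪ (Set.Icc α β)ᶜ := by
    intro x hx
    by_cases hxI : x ∈ Set.Icc α β
    · left
      have hmulR : 0 ≤ (t - 1) * (x₀ - sInf J) := mul_nonneg (by linarith) (by linarith)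
      have hmulL : 0 ≤ (t - 1) * (sSup J - x₀) := mul_nonneg (by linarith) (by linarith)
      rcases le_or_gt x (sSup J) with h1 | h1
      · rcases le_or_gt (sInf J) x with h2 | h2
        · exfalso
          have := far x hxI hx (sInf J) (sSup J) hα hβ le_rfl le_rfl ⟨h2, h1⟩
          nlinarith
        · right
          have := far x hxI hx x (sSup J) hxI.1 hβ h2.le le_rfl ⟨le_rfl, h1⟩
          simp only [Set.mem_Iio]
          linarith
      · left
        have := far x hxI hx (sInf J) x hα hxI.2 le_rfl h1.le ⟨by linarith, le_rfl⟩
        simp only [Set.mem_Ioi]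
        linarith
    · right; exact hxI
  have outJ : ∀ y, y ∉ J → r y ≤ r x₀ / Real.exp 1 := fun y hy => not_lt.1 hy
  have R := hr.lintegral_Ioi_le hr0 hx₀ (b := sSup J - x₀) (by linarith)
    (fun y hy => outJ y fun h => by linarith [le_csSup hJa h]) ht1
  have L := hr.lintegral_Iio_le hr0 hx₀ (b := x₀ - sInf J) (by linarith)
    (fun y hy => outJ y fun h => by linarith [csInf_le hJb h]) ht1
  have O : ∫⁻ x in (Set.Icc α β)ᶜ, ENNReal.ofReal (r x) = 0 := by
    rw [setLIntegral_congr_fun (g := fun _ => 0) measurableSet_Icc.compl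
      fun x hx => by simp [hsupp x hx]]
    simp
  have mass : ENNReal.ofReal (τ * (sSup J - sInf J)) ≤ ∫⁻ x, ENNReal.ofReal (r x) := by
    rw [ENNReal.ofReal_mul hτ0.le, ← volume_of_ordConnected (hr.ordConnected_superlevel hτ0.le)
      hJne hJb hJa, ← setLIntegral_const]
    refine le_trans ?_ (setLIntegral_le_lintegral J _)
    exact setLIntegral_mono' (hr.ordConnected_superlevel hτ0.le).measurableSet
      fun x hx => ENNReal.ofReal_le_ofReal (le_of_lt hx)
  calc _ ≤ ∫⁻ x in (Set.Ioi (x₀ + t * (sSup J - x₀)) ∪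
      Set.Iio (x₀ - t * (x₀ - sInf J))) ∪ (Set.Icc α β)ᶜ, ENNReal.ofReal (r x) :=
        lintegral_mono_set sub
    _ ≤ (ENNReal.ofReal (r x₀ * (sSup J - x₀) * Real.exp (-t)) +
        ENNReal.ofReal (r x₀ * (x₀ - sInf J) * Real.exp (-t))) + 0 := by
        refine (lintegral_union_le _ _ _).trans (add_le_add ?_ O.le)
        exact (lintegral_union_le _ _ _).trans (add_le_add R L)
    _ = ENNReal.ofReal (Real.exp 1 * Real.exp (-t)) *
        ENNReal.ofReal (τ * (sSup J - sInf J)) := by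
        have p1 : 0 ≤ sSup J - x₀ := by linarith
        have p2 : 0 ≤ x₀ - sInf J := by linarith
        rw [add_zero, ← ENNReal.ofReal_add (by positivity) (by positivity),
          ← ENNReal.ofReal_mul (by positivity)]
        congr 1
        rw [hMτ]
        ring
    _ ≤ _ := by gcongr

/-! ### From tail bounds to moments -/

theorem lintegral_rpow_le_of_exp_tail {X : Type*} [MeasurableSpace X] {ν : Measure X} {u : X → ℝ}
    (hu : Measurable u) (hu0 : ∀ x, 0 ≤ u x) {a C : ℝ} {I : ℝ≥0∞} (ha : 0 < a) (hC : 0 ≤ C)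
    (h : ∀ t, 0 < t → ν {x | t < u x} ≤ ENNReal.ofReal (C * Real.exp (-t)) * I) :
    ∫⁻ x, ENNReal.ofReal (u x ^ a) ∂ν ≤ ENNReal.ofReal (C * Real.Gamma (a + 1)) * I := by
  rw [lintegral_rpow_eq_lintegral_meas_lt_mul ν (.of_forall hu0) hu.aemeasurable ha]
  calc _ ≤ ENNReal.ofReal a * ∫⁻ t in Set.Ioi (0 : ℝ),
        ENNReal.ofReal (C * (Real.exp (-t) * t ^ (a - 1))) * I := by
        refine mul_le_mul' le_rfl (setLIntegral_mono' measurableSet_Ioi fun t ht => ?_)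
        have ht' : (0 : ℝ) < t := ht
        calc _ ≤ ENNReal.ofReal (C * Real.exp (-t)) * I * ENNReal.ofReal (t ^ (a - 1)) := by
              gcongr
              exact h t ht
          _ = _ := by
              rw [mul_right_comm, ← ENNReal.ofReal_mul (by positivity)]
              ring_nf
    _ = _ := by
        rw [lintegral_mul_const _ (by fun_prop), ← ofReal_integral_eq_lintegral_ofReal,
          integral_const_mul, ← Real.Gamma_eq_integral ha, ← mul_assoc,
          ← ENNReal.ofReal_mul ha.le, Real.Gamma_add_one ha.ne']
        · ring_nf
        · exact (Real.GammaIntegral_convergent ha).const_mul C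
        · filter_upwards [ae_restrict_mem measurableSet_Ioi] with t ht
          have ht' : (0 : ℝ) < t := ht
          positivity

/-- The layer-cake integral is split at t = κ, where the weak bound meets the trivial one; b(1/b +
1/(1-b)) = 1/(1-b). -/
theorem lintegral_rpow_le_of_weak_tail {X : Type*} [MeasurableSpace X] {ν : Measure X} {u : X → ℝ}
    (hu : Measurable u) (hu0 : ∀ x, 0 ≤ u x) {b κ : ℝ} {I : ℝ≥0∞} (hb : 0 < b) (hb1 : b < 1)
    (hκ : 0 < κ) (hI : ν Set.univ ≤ I)
    (h : ∀ t, 0 < t → ν {x | t < u x} ≤ ENNReal.ofReal (κ / t) * I) :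
    ∫⁻ x, ENNReal.ofReal (u x ^ b) ∂ν ≤ ENNReal.ofReal (κ ^ b / (1 - b)) * I := by
  rw [lintegral_rpow_eq_lintegral_meas_lt_mul ν (.of_forall hu0) hu.aemeasurable hb,
    ← Set.Ioc_union_Ioi_eq_Ioi hκ.le]
  have e1 : ∫⁻ t in Set.Ioc 0 κ, ν {x | t < u x} * ENNReal.ofReal (t ^ (b - 1)) ≤
      ENNReal.ofReal (κ ^ b / b) * I := by
    calc _ ≤ ∫⁻ t in Set.Ioc 0 κ, I * ENNReal.ofReal (t ^ (b - 1)) := by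
          gcongr with t
          exact (measure_mono (Set.subset_univ _)).trans hI
      _ = _ := by
          rw [lintegral_const_mul _ (by fun_prop), mul_comm,
            ← ofReal_integral_eq_lintegral_ofReal]
          · rw [← intervalIntegral.integral_of_le hκ.le, integral_rpow (Or.inl (by linarith))]
            simp [Real.zero_rpow hb.ne']
          · exact (intervalIntegrable_iff_integrableOn_Ioc_of_le hκ.le).1
              (intervalIntegral.intervalIntegrable_rpow' (by linarith))
          · filter_upwards [ae_restrict_mem measurableSet_Ioc] with t ht
            have := ht.1
            positivity
  have e2 : ∫⁻ t in Set.Ioi κ, ν {x | t < u x} * ENNReal.ofReal (t ^ (b - 1)) ≤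
      ENNReal.ofReal (κ ^ b / (1 - b)) * I := by
    calc _ ≤ ∫⁻ t in Set.Ioi κ, ENNReal.ofReal (κ * t ^ (b - 2)) * I := by
          refine setLIntegral_mono' measurableSet_Ioi fun t ht => ?_
          have ht' : 0 < t := hκ.trans ht
          calc _ ≤ ENNReal.ofReal (κ / t) * I * ENNReal.ofReal (t ^ (b - 1)) := by
                gcongr
                exact h t ht'
            _ = _ := by
                rw [mul_right_comm, ← ENNReal.ofReal_mul (by positivity),
                  show b - 2 = b - 1 - 1 by ring, Real.rpow_sub_one ht'.ne' (b - 1)]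
                congr 2
                ring
      _ = _ := by
          rw [lintegral_mul_const _ (by fun_prop), ← ofReal_integral_eq_lintegral_ofReal,
            integral_const_mul, integral_Ioi_rpow_of_lt (by linarith) hκ]
          · congr 2
            rw [show b - 2 + 1 = b - 1 by ring, Real.rpow_sub_one hκ.ne']
            have : 1 - b ≠ 0 := by linarith
            have : b - 1 ≠ 0 := by linarith
            field_simp
            ring
          · exact (integrableOn_Ioi_rpow_of_lt (by linarith) hκ).const_mul κ
          · filter_upwards [ae_restrict_mem measurableSet_Ioi] with t ht
            have ht' : 0 < t := hκ.trans ht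
            positivity
  have h1b : 0 < 1 - b := by linarith
  calc _ ≤ ENNReal.ofReal b * (ENNReal.ofReal (κ ^ b / b) * I +
        ENNReal.ofReal (κ ^ b / (1 - b)) * I) := by
        gcongr
        exact (lintegral_union_le _ _ _).trans (add_le_add e1 e2)
    _ = _ := by
        rw [← add_mul, ← mul_assoc, ← ENNReal.ofReal_add (by positivity) (by positivity),
          ← ENNReal.ofReal_mul hb.le]
        congr 2
        field_simp
        ring

/-- On the line, the moments of positive and small negative order of a function satisfying a
Remez inequality are controlled by one and the same level `S`. -/
theorem exists_level_moments {r g : ℝ → ℝ} {d α β : ℝ} (hr : LogConcaveOnLine r)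
    (hr0 : ∀ x, 0 ≤ r x) (hrm : Measurable r) (hrb : BddAbove (Set.range r))
    (hsupp : ∀ x, x ∉ Set.Icc α β → r x = 0) (hI : ∫⁻ x, ENNReal.ofReal (r x) ≠ 0)
    (hg : Continuous g) (hg0 : ∀ x, 0 ≤ g x) (hgpos : ∃ x ∈ Set.Icc α β, 0 < g x)
    (hd : 0 < d) (hR : RemezOnInterval g d α β) {m p : ℝ} (hm : 0 < m) (hp : 0 < p)
    (hpd : p * d < 1) :
    ∃ S : ℝ, 0 < S ∧
      ∫⁻ x, ENNReal.ofReal (g x ^ m) ∂(volume.withDensity fun x => ENNReal.ofReal (r x)) ≤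
        ENNReal.ofReal (S ^ m * (4 ^ (m * d) * (Real.exp 1 * Real.Gamma (m * d + 1)))) *
          ∫⁻ x, ENNReal.ofReal (r x) ∧
      ∀ ε : ℝ, 0 < ε →
        ∫⁻ x, ENNReal.ofReal ((g x + ε) ^ (-p))
            ∂(volume.withDensity fun x => ENNReal.ofReal (r x)) ≤
          ENNReal.ofReal (S ^ (-p) * (4 ^ (p * d) * (2 * Real.exp 1 / (1 - p * d)))) *
            ∫⁻ x, ENNReal.ofReal (r x) := by
  set I := ∫⁻ x, ENNReal.ofReal (r x) with hIdef
  set ν := volume.withDensity fun x => ENNReal.ofReal (r x) with hν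
  have hgm := hg.measurable
  have hne : ∀ x₀, ∃ x₁ ≠ x₀, 0 < r x₁ := by
    intro x₀
    by_contra! hcon
    apply hI
    have hz : ∀ᵐ x ∂(volume : Measure ℝ), ENNReal.ofReal (r x) = 0 := by
      filter_upwards [(measure_singleton x₀ : volume {x₀} = 0) |> compl_mem_ae_iff.2] with x hx
      exact ENNReal.ofReal_eq_zero.2 (hcon x hx)
    rw [hIdef, lintegral_congr_ae hz]
    simp
  obtain ⟨x₀, hx₀, hx₀2⟩ := exists_half_sup hrb ((hne 0).imp fun x hx => hx.2)
  obtain ⟨x₁, hx₁ne, hx₁⟩ := hne x₀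
  have hτ : r x₀ / Real.exp 1 < r x₀ := div_lt_self hx₀ (Real.one_lt_exp_iff.2 zero_lt_one)
  have hτ0 : 0 ≤ r x₀ / Real.exp 1 := by positivity
  obtain ⟨y, hyne, hy⟩ := hr.exists_ne_superlevel hx₀ hx₁ hx₁ne hτ
  set J := {x | r x₀ / Real.exp 1 < r x} with hJdef
  have hJI : J ⊆ Set.Icc α β := superlevel_subset_Icc hsupp hτ0
  have hJb : BddBelow J := bddBelow_Icc.mono hJI
  have hJa : BddAbove J := bddAbove_Icc.mono hJI
  have hx₀J : x₀ ∈ J := hτ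
  have hyJ : y ∈ J := hy
  have hJne : J.Nonempty := ⟨x₀, hx₀J⟩
  have hJ : sInf J < sSup J := by
    rcases lt_or_gt_of_ne hyne with h | h
    · exact (csInf_le hJb hyJ).trans_lt (h.trans_le (le_csSup hJa hx₀J))
    · exact (csInf_le hJb hx₀J).trans_lt (h.trans_le (le_csSup hJa hyJ))
  have hα : α ≤ sInf J := le_csInf hJne fun x hx => (hJI hx).1
  have hβ : sSup J ≤ β := csSup_le hJne fun x hx => (hJI hx).2
  obtain ⟨xs, hxs, hmax⟩ := (isCompact_Icc (a := sInf J) (b := sSup J)).exists_isMaxOn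
    ⟨_, Set.left_mem_Icc.2 hJ.le⟩ hg.continuousOn
  have hmax' : ∀ x ∈ Set.Icc (sInf J) (sSup J), g x ≤ g xs := fun x hx => hmax hx
  -- If `g` vanished on the closure of `J`, Remez would make it vanish on all of [α, β].
  have hS : 0 < g xs := by
    by_contra hcon
    have h0 : g xs = 0 := le_antisymm (not_lt.1 hcon) (hg0 _)
    obtain ⟨x, hx, hgx⟩ := hgpos
    have := hR α β le_rfl (hα.trans_lt (hJ.trans_le hβ)) le_rfl (Set.Icc (sInf J) (sSup J))
      (Set.Icc_subset_Icc hα hβ) measurableSet_Icc (by rw [Real.volume_Icc]; simpa using hJ) 0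
      (fun z hz => (hmax' z hz).trans h0.le) x hx
    linarith
  set S := g xs with hSdef
  have hνuniv : ν Set.univ = I := by
    rw [hν, withDensity_apply _ MeasurableSet.univ, Measure.restrict_univ]
  refine ⟨S, hS, ?_, fun ε hε => ?_⟩
  · set u : ℝ → ℝ := fun x => (g x / S) ^ (1 / d) / 4 with hu
    have hu0 : ∀ x, 0 ≤ u x := fun x => by
      have := hg0 x
      positivity
    have hum : Measurable u := ((hgm.div_const S).pow_const _).div_const 4
    have tail := lintegral_rpow_le_of_exp_tail (ν := ν) (I := I) hum hu0 (mul_pos hm hd)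
      (Real.exp_pos 1).le (fun t ht => by
        have hset : {x | t < u x} = {x | S * (4 * t) ^ d < g x} := by
          ext x
          have h1 : (0 : ℝ) ≤ g x / S := div_nonneg (hg0 x) hS.le
          change t < (g x / S) ^ (1 / d) / 4 ↔ S * (4 * t) ^ d < g x
          rw [lt_div_iff₀ (by norm_num), mul_comm t 4, one_div,
            Real.lt_rpow_inv_iff_of_pos (by positivity) h1 hd, lt_div_iff₀ hS, mul_comm S]
        rw [hset, hν, withDensity_apply _ (measurableSet_lt measurable_const hgm)]
        exact upper_tail hr hr0 hsupp hd hR hx₀ hJ hmax' hS ht)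
    have hgu : ∀ x, g x ^ m = S ^ m * 4 ^ (m * d) * u x ^ (m * d) := by
      intro x
      have h1 : (0 : ℝ) ≤ g x / S := div_nonneg (hg0 x) hS.le
      rw [hu]
      simp only
      rw [Real.div_rpow (by positivity) (by norm_num), ← Real.rpow_mul h1,
        show 1 / d * (m * d) = m by field_simp, Real.div_rpow (hg0 x) hS.le]
      field_simp
    simp_rw [hgu]
    calc _ = ENNReal.ofReal (S ^ m * 4 ^ (m * d)) * ∫⁻ x, ENNReal.ofReal (u x ^ (m * d)) ∂ν := by
          rw [← lintegral_const_mul _ (by fun_prop)]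
          simp_rw [ENNReal.ofReal_mul (show 0 ≤ S ^ m * (4 : ℝ) ^ (m * d) by positivity)]
      _ ≤ ENNReal.ofReal (S ^ m * 4 ^ (m * d)) *
          (ENNReal.ofReal (Real.exp 1 * Real.Gamma (m * d + 1)) * I) := by gcongr
      _ = _ := by
          rw [← mul_assoc, ← ENNReal.ofReal_mul (by positivity)]
          ring_nf
  · set u : ℝ → ℝ := fun x => (g x + ε) ^ (-(1 / d)) with hu
    have hgε : ∀ x, 0 < g x + ε := fun x => by linarith [hg0 x]
    have hu0 : ∀ x, 0 ≤ u x := fun x => Real.rpow_nonneg (hgε x).le _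
    have hum : Measurable u := (hgm.add_const ε).pow_const _
    have tail := lintegral_rpow_le_of_weak_tail (ν := ν) (I := I) hum hu0 (mul_pos hp hd) hpd
      (κ := 8 * Real.exp 1 * S ^ (-(1 / d))) (by positivity) hνuniv.le (fun t ht => by
        have hsub : {x | t < u x} ⊆ {x | g x < t ^ (-d)} := by
          intro x hx
          have hx' : t < (g x + ε) ^ (-(1 / d)) := hx
          change g x < t ^ (-d)
          have h1 := Real.rpow_lt_rpow_of_neg ht hx' (neg_lt_zero.2 hd)
          rw [← Real.rpow_mul (hgε x).le, neg_mul_neg, one_div_mul_cancel hd.ne',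
            Real.rpow_one] at h1
          linarith
        refine (measure_mono hsub).trans ?_
        rw [hν, withDensity_apply _ (measurableSet_lt hgm measurable_const)]
        refine (small_ball hr hr0 hrm hsupp hgm hd hR hx₀ hx₀2 hJ hxs hS
          (Real.rpow_pos_of_pos ht _)).trans (le_of_eq ?_)
        congr 2
        rw [Real.div_rpow (by positivity) hS.le, ← Real.rpow_mul ht.le,
          show -d * (1 / d) = -1 by field_simp, Real.rpow_neg_one, Real.rpow_neg hS.le]
        field_simp)
    have hgu : ∀ x, (g x + ε) ^ (-p) = u x ^ (p * d) := by
      intro x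
      rw [hu]
      simp only
      rw [← Real.rpow_mul (hgε x).le]
      congr 1
      field_simp
    simp_rw [hgu]
    refine tail.trans ?_
    gcongr ENNReal.ofReal ?_ * I
    have h1 : 0 < 1 - p * d := by linarith
    have hpd0 : 0 < p * d := mul_pos hp hd
    have e1 : (8 * Real.exp 1 * S ^ (-(1 / d))) ^ (p * d) =
        4 ^ (p * d) * (2 * Real.exp 1) ^ (p * d) * S ^ (-p) := by
      rw [show 8 * Real.exp 1 = 4 * (2 * Real.exp 1) by ring,
        Real.mul_rpow (by positivity) (by positivity), Real.mul_rpow (by positivity)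
        (by positivity), ← Real.rpow_mul hS.le]
      congr 2
      field_simp
    -- Since p * d < 1 and 2e ≥ 1, the exponent may be raised to 1; only the power of 4 keeps its
    -- dependence on d.
    have e2 : (2 * Real.exp 1) ^ (p * d) ≤ 2 * Real.exp 1 := by
      conv_rhs => rw [← Real.rpow_one (2 * Real.exp 1)]
      refine Real.rpow_le_rpow_of_exponent_le ?_ hpd.le
      have := Real.one_le_exp (zero_le_one' ℝ)
      linarith
    rw [e1]
    calc _ ≤ 4 ^ (p * d) * (2 * Real.exp 1) * S ^ (-p) / (1 - p * d) := by gcongr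
      _ = _ := by ring

/-! ### Bisection by half-spaces and localization -/

theorem volume_hyperplane {k : ℕ} {i j : Fin k} (hij : i ≠ j) {a b : ℝ} (hab : a ≠ 0 ∨ b ≠ 0)
    (c : ℝ × ℝ) :
    volume {x : Fin k → ℝ | a * (x i - c.1) + b * (x j - c.2) = 0} = 0 := by
  set L : (Fin k → ℝ) →ₗ[ℝ] ℝ := a • LinearMap.proj i + b • LinearMap.proj j with hL
  have hLx : ∀ x, L x = a * x i + b * x j := fun x => by simp [hL]
  rcases Set.eq_empty_or_nonempty {x : Fin k → ℝ | a * (x i - c.1) + b * (x j - c.2) = 0}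
    with h | ⟨p, hp⟩
  · rw [h]; simp
  have hp' : a * (p i - c.1) + b * (p j - c.2) = 0 := hp
  have hsub : {x : Fin k → ℝ | a * (x i - c.1) + b * (x j - c.2) = 0} ⊆
      (AffineSubspace.mk' p (LinearMap.ker L) : Set (Fin k → ℝ)) := by
    intro x hx
    have hx' : a * (x i - c.1) + b * (x j - c.2) = 0 := hx
    rw [SetLike.mem_coe, AffineSubspace.mem_mk', LinearMap.mem_ker, vsub_eq_sub, map_sub,
      hLx, hLx]
    linarith
  refine measure_mono_null hsub (Measure.addHaar_affineSubspace _ _ fun htop => ?_)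
  have hker : LinearMap.ker L = ⊤ := by
    rw [← AffineSubspace.direction_mk' p (LinearMap.ker L), htop, AffineSubspace.direction_top]
  rw [LinearMap.ker_eq_top] at hker
  have h1 : L (Pi.single i 1) = a := by rw [hLx]; simp [hij.symm]
  have h2 : L (Pi.single j 1) = b := by rw [hLx]; simp [hij]
  rw [hker] at h1 h2
  rcases hab with h | h
  · exact h (by simpa using h1.symm)
  · exact h (by simpa using h2.symm)

/-- The closed half-space with conormal at angle `θ` in the `(i, j)`-plane, through `c`. -/
def halfSpace {k : ℕ} (i j : Fin k) (c : ℝ × ℝ) (θ : ℝ) : Set (Fin k → ℝ) :=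
  {x | 0 ≤ Real.cos θ * (x i - c.1) + Real.sin θ * (x j - c.2)}

theorem isClosed_halfSpace {k : ℕ} (i j : Fin k) (c : ℝ × ℝ) (θ : ℝ) :
    IsClosed (halfSpace i j c θ) :=
  isClosed_le continuous_const (by fun_prop)

theorem convex_halfSpace {k : ℕ} (i j : Fin k) (c : ℝ × ℝ) (θ : ℝ) :
    Convex ℝ (halfSpace i j c θ) := by
  intro x hx y hy a b ha hb hab
  have hx' : 0 ≤ Real.cos θ * (x i - c.1) + Real.sin θ * (x j - c.2) := hx
  have hy' : 0 ≤ Real.cos θ * (y i - c.1) + Real.sin θ * (y j - c.2) := hy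
  change 0 ≤ Real.cos θ * ((a • x + b • y) i - c.1) + Real.sin θ * ((a • x + b • y) j - c.2)
  have := add_nonneg (mul_nonneg ha hx') (mul_nonneg hb hy')
  refine this.trans_eq ?_
  obtain rfl : b = 1 - a := by linarith
  simp only [Pi.add_apply, Pi.smul_apply, smul_eq_mul]
  ring

theorem cos_sin_ne_zero (θ : ℝ) : Real.cos θ ≠ 0 ∨ Real.sin θ ≠ 0 := by
  by_contra! h
  have := Real.cos_sq_add_sin_sq θ
  rw [h.1, h.2] at this
  norm_num at this

section bisection

variable {k : ℕ} {μ : Measure (Fin k → ℝ)} {i j : Fin k} {P : Set (Fin k → ℝ)}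
  {u : (Fin k → ℝ) → ℝ}

theorem integral_halfSpace_add (hμ : μ ≪ volume) (hij : i ≠ j) (hP : MeasurableSet P)
    (hu : IntegrableOn u P μ) (c : ℝ × ℝ) (θ : ℝ) :
    ∫ x in P ∩ halfSpace i j c θ, u x ∂μ + ∫ x in P ∩ halfSpace i j c (θ + Real.pi), u x ∂μ =
      ∫ x in P, u x ∂μ := by
  have hnull := hμ (volume_hyperplane hij (cos_sin_ne_zero θ) c)
  rw [← setIntegral_union₀ _
    (hP.inter (isClosed_halfSpace _ _ _ _).measurableSet).nullMeasurableSet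
    (hu.mono_set Set.inter_subset_left) (hu.mono_set Set.inter_subset_left)]
  · congr 2
    rw [← Set.inter_union_distrib_left, Set.inter_eq_left]
    intro x _
    rcases le_total 0 (Real.cos θ * (x i - c.1) + Real.sin θ * (x j - c.2)) with h | h
    · left; exact h
    · right
      change 0 ≤ Real.cos (θ + Real.pi) * (x i - c.1) + Real.sin (θ + Real.pi) * (x j - c.2)
      rw [Real.cos_add_pi, Real.sin_add_pi]
      linarith
  · refine measure_mono_null ?_ hnull
    rintro x ⟨⟨_, h1⟩, ⟨_, h2⟩⟩
    have h1' : 0 ≤ Real.cos θ * (x i - c.1) + Real.sin θ * (x j - c.2) := h1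
    have h2' : 0 ≤ Real.cos (θ + Real.pi) * (x i - c.1) +
      Real.sin (θ + Real.pi) * (x j - c.2) := h2
    rw [Real.cos_add_pi, Real.sin_add_pi] at h2'
    change Real.cos θ * (x i - c.1) + Real.sin θ * (x j - c.2) = 0
    linarith

/-- Dominated convergence: off the bounding hyperplane, which is null, the indicator is locally
constant in the angle. -/
theorem continuous_integral_halfSpace (hμ : μ ≪ volume) (hij : i ≠ j)
    (hu : IntegrableOn u P μ) (c : ℝ × ℝ) :
    Continuous fun θ => ∫ x in P ∩ halfSpace i j c θ, u x ∂μ := by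
  have hm : ∀ θ, MeasurableSet (halfSpace i j c θ) := fun θ =>
    (isClosed_halfSpace i j c θ).measurableSet
  have e : ∀ θ, ∫ x in P ∩ halfSpace i j c θ, u x ∂μ =
      ∫ x in P, (halfSpace i j c θ).indicator u x ∂μ := fun θ => by
    rw [setIntegral_indicator (hm θ)]
  simp_rw [e]
  refine continuous_iff_continuousAt.2 fun θ => ?_
  refine continuousAt_of_dominated (bound := fun x => ‖u x‖)
    (.of_forall fun θ => hu.aestronglyMeasurable.indicator (hm θ))
    (.of_forall fun θ => .of_forall fun x => norm_indicator_le_norm_self _ _) hu.norm ?_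
  have hnull := (Measure.absolutelyContinuous_of_le Measure.restrict_le_self :
    μ.restrict P ≪ μ) (hμ (volume_hyperplane hij (cos_sin_ne_zero θ) c))
  filter_upwards [compl_mem_ae_iff.2 hnull] with x hx
  have hx' : Real.cos θ * (x i - c.1) + Real.sin θ * (x j - c.2) ≠ 0 := hx
  have hc : Continuous fun t : ℝ => Real.cos t * (x i - c.1) + Real.sin t * (x j - c.2) := by
    fun_prop
  rcases lt_or_gt_of_ne hx' with h | h
  · refine (continuousAt_const (y := (0 : ℝ))).congr ?_
    filter_upwards [hc.continuousAt.eventually (gt_mem_nhds h)] with t ht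
    rw [Set.indicator_of_notMem]
    exact not_le.2 ht
  · refine (continuousAt_const (y := u x)).congr ?_
    filter_upwards [hc.continuousAt.eventually (lt_mem_nhds h)] with t ht
    rw [Set.indicator_of_mem]
    exact le_of_lt ht

end bisection

/-- The compact convex subsets of `V` on which both `g₁` and `g₂` have positive integral. -/
structure IsPositivePiece {k : ℕ} (μ : Measure (Fin k → ℝ)) (V : Set (Fin k → ℝ))
    (g₁ g₂ : (Fin k → ℝ) → ℝ) (P : Set (Fin k → ℝ)) : Prop where
  isCompact : IsCompact P
  convex : Convex ℝ P
  subset : P ⊆ V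
  pos₁ : 0 < ∫ x in P, g₁ x ∂μ
  pos₂ : 0 < ∫ x in P, g₂ x ∂μ

section needle

variable {k : ℕ} {μ : Measure (Fin k → ℝ)} {V : Set (Fin k → ℝ)} {g₁ g₂ : (Fin k → ℝ) → ℝ}

/-- The angles θ and θ + π give complementary halves, so by the intermediate value theorem some
angle halves the integral of `g₁`. The two integrals of `g₂` have a positive sum, so one half keeps
both positive. -/
theorem IsPositivePiece.exists_bisection (hμ : μ ≪ volume) (h₁ : IntegrableOn g₁ V μ)
    (h₂ : IntegrableOn g₂ V μ) {P : Set (Fin k → ℝ)} (hP : IsPositivePiece μ V g₁ g₂ P)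
    {i j : Fin k} (hij : i ≠ j) (c : ℝ × ℝ) :
    ∃ θ, IsPositivePiece μ V g₁ g₂ (P ∩ halfSpace i j c θ) := by
  have hPm := hP.isCompact.measurableSet
  have i₁ := h₁.mono_set hP.subset
  have i₂ := h₂.mono_set hP.subset
  have hcont := continuous_integral_halfSpace hμ hij i₁ c
  have hadd := integral_halfSpace_add hμ hij hPm i₁ c
  obtain ⟨θ, hθ⟩ : ∃ θ, ∫ x in P ∩ halfSpace i j c θ, g₁ x ∂μ = (∫ x in P, g₁ x ∂μ) / 2 := by
    have h0 := hadd 0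
    rcases le_total (∫ x in P ∩ halfSpace i j c 0, g₁ x ∂μ) ((∫ x in P, g₁ x ∂μ) / 2) with h | h
    · exact mem_range_of_exists_le_of_exists_ge hcont ⟨0, h⟩ ⟨0 + Real.pi, by linarith⟩
    · exact mem_range_of_exists_le_of_exists_ge hcont ⟨0 + Real.pi, by linarith⟩ ⟨0, h⟩
  have hp := hP.pos₁
  have h1 := hadd θ
  have h2 := integral_halfSpace_add hμ hij hPm i₂ c θ
  have build : ∀ t, 0 < ∫ x in P ∩ halfSpace i j c t, g₁ x ∂μ →
      0 < ∫ x in P ∩ halfSpace i j c t, g₂ x ∂μ →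
      IsPositivePiece μ V g₁ g₂ (P ∩ halfSpace i j c t) := fun t a b =>
    ⟨hP.isCompact.inter_right (isClosed_halfSpace _ _ _ _),
      hP.convex.inter (convex_halfSpace _ _ _ _), Set.inter_subset_left.trans hP.subset, a, b⟩
  rcases lt_or_ge 0 (∫ x in P ∩ halfSpace i j c θ, g₂ x ∂μ) with h | h
  · exact ⟨θ, build θ (by linarith) h⟩
  · exact ⟨θ + Real.pi, build _ (by linarith) (by linarith [hP.pos₂])⟩

/-- Three points projecting to a nondegenerate triangle admit a point, in any dense sequence, that
no half-plane containing the triangle has on its boundary. -/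
theorem exists_dense_mem_triangle {s : ℕ → ℝ × ℝ} (hs : DenseRange s) {x y z : ℝ × ℝ}
    (hdet : (y.1 - x.1) * (z.2 - x.2) - (y.2 - x.2) * (z.1 - x.1) ≠ 0) :
    ∃ n, ∀ a b : ℝ, 0 ≤ a * (x.1 - (s n).1) + b * (x.2 - (s n).2) →
      0 ≤ a * (y.1 - (s n).1) + b * (y.2 - (s n).2) →
      0 ≤ a * (z.1 - (s n).1) + b * (z.2 - (s n).2) → a = 0 ∧ b = 0 := by
  set D := (y.1 - x.1) * (z.2 - x.2) - (y.2 - x.2) * (z.1 - x.1) with hD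
  -- `S` and `T` are the barycentric coordinates of c at y and z. An affine form vanishing at an
  -- interior point and nonnegative at the vertices vanishes at all of them.
  set S : ℝ × ℝ → ℝ := fun c => ((c.1 - x.1) * (z.2 - x.2) - (c.2 - x.2) * (z.1 - x.1)) / D
  set T : ℝ × ℝ → ℝ := fun c => ((y.1 - x.1) * (c.2 - x.2) - (y.2 - x.2) * (c.1 - x.1)) / D
  have hSc : Continuous S := by fun_prop
  have hTc : Continuous T := by fun_prop
  have hopen : IsOpen {c | 0 < S c ∧ 0 < T c ∧ S c + T c < 1} :=
    (isOpen_lt continuous_const hSc).inter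
      ((isOpen_lt continuous_const hTc).inter (isOpen_lt (hSc.add hTc) continuous_const))
  obtain ⟨n, h1, h2, h3⟩ := hs.exists_mem_open hopen
    ⟨((x.1 + y.1 + z.1) / 3, (x.2 + y.2 + z.2) / 3), by
      have e1 : S ((x.1 + y.1 + z.1) / 3, (x.2 + y.2 + z.2) / 3) = 1 / 3 := by
        simp only [S]
        rw [div_eq_iff hdet, hD]
        ring
      have e2 : T ((x.1 + y.1 + z.1) / 3, (x.2 + y.2 + z.2) / 3) = 1 / 3 := by
        simp only [T]
        rw [div_eq_iff hdet, hD]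
        ring
      refine ⟨?_, ?_, ?_⟩
      · rw [e1]; norm_num
      · rw [e2]; norm_num
      · rw [e1, e2]; norm_num⟩
  refine ⟨n, fun a b hx hy hz => ?_⟩
  set c := s n
  have c1 : c.1 - x.1 = S c * (y.1 - x.1) + T c * (z.1 - x.1) := by
    simp only [S, T]
    field_simp
    rw [hD]
    ring
  have c2 : c.2 - x.2 = S c * (y.2 - x.2) + T c * (z.2 - x.2) := by
    simp only [S, T]
    field_simp
    rw [hD]
    ring
  have hsum : (1 - S c - T c) * (a * (x.1 - c.1) + b * (x.2 - c.2)) +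
      S c * (a * (y.1 - c.1) + b * (y.2 - c.2)) +
      T c * (a * (z.1 - c.1) + b * (z.2 - c.2)) = 0 := by
    linear_combination (-a) * c1 - b * c2
  have hx0 : a * (x.1 - c.1) + b * (x.2 - c.2) = 0 := by
    have p0 : 0 < 1 - S c - T c := by linarith
    have p1 := mul_nonneg p0.le hx
    have p2 := mul_nonneg h1.le hy
    have p3 := mul_nonneg h2.le hz
    have : (1 - S c - T c) * (a * (x.1 - c.1) + b * (x.2 - c.2)) = 0 := by linarith
    exact (mul_eq_zero.1 this).resolve_left p0.ne'
  have hy0 : a * (y.1 - c.1) + b * (y.2 - c.2) = 0 := by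
    rw [hx0] at hsum
    have p2 := mul_nonneg h1.le hy
    have p3 := mul_nonneg h2.le hz
    have : S c * (a * (y.1 - c.1) + b * (y.2 - c.2)) = 0 := by linarith
    exact (mul_eq_zero.1 this).resolve_left h1.ne'
  have hz0 : a * (z.1 - c.1) + b * (z.2 - c.2) = 0 := by
    rw [hx0, hy0] at hsum
    have : T c * (a * (z.1 - c.1) + b * (z.2 - c.2)) = 0 := by linarith
    exact (mul_eq_zero.1 this).resolve_left h2.ne'
  constructor
  · refine (mul_eq_zero.1 (?_ : a * D = 0)).resolve_right hdet
    rw [hD]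
    linear_combination (z.2 - x.2) * (hy0 - hx0) - (y.2 - x.2) * (hz0 - hx0)
  · refine (mul_eq_zero.1 (?_ : b * D = 0)).resolve_right hdet
    rw [hD]
    linear_combination (y.1 - x.1) * (hz0 - hx0) - (z.1 - x.1) * (hy0 - hx0)

/-- A set all of whose planar projections are collinear is a graph over one coordinate. -/
theorem exists_coord_norm_sub_le {k : ℕ} (Q : Set (Fin (k + 1) → ℝ))
    (hQ : ∀ x ∈ Q, ∀ y ∈ Q, ∀ z ∈ Q, ∀ i j : Fin (k + 1),
      (y i - x i) * (z j - x j) - (y j - x j) * (z i - x i) = 0) :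
    ∃ i, ∀ z ∈ Q, ∀ z' ∈ Q, ‖z - z'‖ ≤ |z i - z' i| := by
  rcases Q.subsingleton_or_nontrivial with h | ⟨x, hx, y, hy, hxy⟩
  · refine ⟨0, fun z hz z' hz' => ?_⟩
    rw [h hz hz']
    simp
  -- The coordinate in which a fixed pair x, y differs most dominates the sup norm along their line.
  obtain ⟨i, -, hi⟩ := Finset.exists_max_image (Finset.univ : Finset (Fin (k + 1)))
    (fun j => |y j - x j|) Finset.univ_nonempty
  have hi0 : y i - x i ≠ 0 := by
    intro h0
    refine hxy (funext fun j => ?_)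
    have := hi j (Finset.mem_univ j)
    rw [h0, abs_zero] at this
    have := abs_eq_zero.1 (le_antisymm this (abs_nonneg _))
    linarith
  refine ⟨i, fun z hz z' hz' => (pi_norm_le_iff_of_nonneg (abs_nonneg _)).2 fun j => ?_⟩
  have e1 := hQ x hx y hy z hz i j
  have e2 := hQ x hx y hy z' hz' i j
  have e3 : (y i - x i) * (z j - z' j) = (y j - x j) * (z i - z' i) := by
    linear_combination e1 - e2
  have e4 : |y i - x i| * |z j - z' j| ≤ |y i - x i| * |z i - z' i| := by
    rw [← abs_mul, e3, abs_mul]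
    exact mul_le_mul_of_nonneg_right (hi j (Finset.mem_univ j)) (abs_nonneg _)
  exact le_of_mul_le_mul_left e4 (abs_pos.2 hi0)

/-- Localization: a positive piece can be cut down to one that is arbitrarily close to a graph
over one of the coordinates. -/
theorem IsPositivePiece.exists_thin {k : ℕ} {μ : Measure (Fin (k + 1) → ℝ)}
    {V : Set (Fin (k + 1) → ℝ)} {g₁ g₂ : (Fin (k + 1) → ℝ) → ℝ} (hμ : μ ≪ volume)
    (h₁ : IntegrableOn g₁ V μ) (h₂ : IntegrableOn g₂ V μ) (hV : IsPositivePiece μ V g₁ g₂ V)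
    {ε : ℝ} (hε : 0 < ε) :
    ∃ P i, IsPositivePiece μ V g₁ g₂ P ∧ ∀ x ∈ P, ∀ y ∈ P, x i = y i → ‖x - y‖ ≤ ε := by
  classical
  obtain ⟨s, hs⟩ := TopologicalSpace.exists_dense_seq (ℝ × ℝ)
  -- Each triple of two coordinates and a centre needs to occur only once, because all later pieces
  -- are subsets of the cut piece.
  obtain ⟨enum, henum⟩ := exists_surjective_nat (Fin (k + 1) × Fin (k + 1) × ℕ)
  let Piece := {P : Set (Fin (k + 1) → ℝ) // IsPositivePiece μ V g₁ g₂ P}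
  have step : ∀ (n : ℕ) (P : Piece), ∃ P' : Piece, P'.1 ⊆ P.1 ∧
      ((enum n).1 ≠ (enum n).2.1 → ∃ θ, P'.1 ⊆
        halfSpace (enum n).1 (enum n).2.1 (s (enum n).2.2) θ) := by
    intro n P
    by_cases hij : (enum n).1 = (enum n).2.1
    · exact ⟨P, subset_rfl, fun h => absurd hij h⟩
    · obtain ⟨θ, hθ⟩ := P.2.exists_bisection hμ h₁ h₂ hij (s (enum n).2.2)
      exact ⟨⟨_, hθ⟩, Set.inter_subset_left, fun _ => ⟨θ, Set.inter_subset_right⟩⟩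
  choose next hnext hnext' using step
  let seq : ℕ → Piece := fun n => Nat.rec ⟨V, hV⟩ (fun n P => next n P) n
  have hseq : ∀ n, seq (n + 1) = next n (seq n) := fun n => rfl
  have hanti : Antitone fun n => (seq n).1 :=
    antitone_nat_of_succ_le fun n => by rw [hseq]; exact hnext n (seq n)
  set Q := ⋂ n, (seq n).1 with hQdef
  have hQ : ∀ x ∈ Q, ∀ y ∈ Q, ∀ z ∈ Q, ∀ i j : Fin (k + 1),
      (y i - x i) * (z j - x j) - (y j - x j) * (z i - x i) = 0 := by
    intro x hx y hy z hz i j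
    by_contra hdet
    obtain ⟨l, hl⟩ := exists_dense_mem_triangle hs (x := (x i, x j)) (y := (y i, y j))
      (z := (z i, z j)) hdet
    have hij : i ≠ j := by
      rintro rfl
      exact hdet (by ring)
    obtain ⟨n, hn⟩ := henum (i, j, l)
    obtain ⟨θ, hθ⟩ := hnext' n (seq n) (by rw [hn]; exact hij)
    rw [hn, ← hseq] at hθ
    have mem : ∀ v ∈ Q, v ∈ halfSpace i j (s l) θ := fun v hv => hθ (Set.mem_iInter.1 hv (n + 1))
    have := hl (Real.cos θ) (Real.sin θ) (mem x hx) (mem y hy) (mem z hz)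
    rcases cos_sin_ne_zero θ with h | h
    · exact h this.1
    · exact h this.2
  obtain ⟨i, hi⟩ := exists_coord_norm_sub_le Q hQ
  -- By compactness a finite stage already lies within ε / 4 of the limit set `Q`.
  obtain ⟨n, hn⟩ := exists_subset_nhds_of_isCompact (V := fun n => (seq n).1)
    hanti.directed_ge (fun n => (seq n).2.isCompact) (U := Metric.thickening (ε / 4) Q)
    (fun x hx => Metric.isOpen_thickening.mem_nhds
      (Metric.self_subset_thickening (by positivity) Q hx))
  refine ⟨(seq n).1, i, (seq n).2, fun x hx y hy hxy => ?_⟩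
  obtain ⟨z, hz, hxz⟩ := Metric.mem_thickening_iff.1 (hn hx)
  obtain ⟨z', hz', hyz⟩ := Metric.mem_thickening_iff.1 (hn hy)
  rw [dist_eq_norm] at hxz hyz
  have a1 : |x i - z i| ≤ ‖x - z‖ := norm_le_pi_norm (x - z) i
  have a2 : |y i - z' i| ≤ ‖y - z'‖ := norm_le_pi_norm (y - z') i
  have a3 : |z i - z' i| ≤ |x i - z i| + |y i - z' i| := by
    have : z i - z' i = -(x i - z i) + (y i - z' i) := by rw [hxy]; ring
    rw [this]
    refine (abs_add_le _ _).trans ?_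
    rw [abs_neg]
  have a4 := hi z hz z' hz'
  -- As x i = y i, the middle term is at most |z i - z' i|, hence at most 2 · ε / 4; the outer two
  -- contribute ε / 4 each.
  calc ‖x - y‖ = ‖(x - z) + (z - z') - (y - z')‖ := by congr 1; abel
    _ ≤ ‖(x - z) + (z - z')‖ + ‖y - z'‖ := norm_sub_le _ _
    _ ≤ ‖x - z‖ + ‖z - z'‖ + ‖y - z'‖ := by gcongr; exact norm_add_le _ _
    _ ≤ ε := by linarith

end needle

/-! ### Log-concave densities and their marginals -/

/-- Bounded measurable multiplicatively log-concave densities. -/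
structure IsLogConcaveDensity {k : ℕ} (H : (Fin k → ℝ) → ℝ) : Prop where
  measurable : Measurable H
  nonneg : ∀ x, 0 ≤ H x
  bounded : ∃ M, ∀ x, H x ≤ M
  logConcave : ∀ w : ℝ, 0 < w → w < 1 → ∀ x y, H x ^ (1 - w) * H y ^ w ≤ H ((1 - w) • x + w • y)

theorem IsLogConcaveDensity.indicator {k : ℕ} {H : (Fin k → ℝ) → ℝ} (hH : IsLogConcaveDensity H)
    {P : Set (Fin k → ℝ)} (hPm : MeasurableSet P) (hPc : Convex ℝ P) :
    IsLogConcaveDensity (P.indicator H) where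
  measurable := hH.measurable.indicator hPm
  nonneg := Set.indicator_nonneg fun x _ => hH.nonneg x
  bounded := by
    obtain ⟨M, hM⟩ := hH.bounded
    exact ⟨M, fun x => (Set.indicator_le_self' (fun _ _ => hH.nonneg _) x).trans (hM x)⟩
  logConcave := by
    intro w h0 h1 x y
    have h1' : 0 < 1 - w := by linarith
    by_cases hx : x ∈ P
    · by_cases hy : y ∈ P
      · rw [Set.indicator_of_mem hx, Set.indicator_of_mem hy,
          Set.indicator_of_mem (hPc hx hy h1'.le h0.le (by ring))]
        exact hH.logConcave w h0 h1 x y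
      · rw [Set.indicator_of_notMem hy, Real.zero_rpow h0.ne', mul_zero]
        exact Set.indicator_nonneg (fun x _ => hH.nonneg x) _
    · rw [Set.indicator_of_notMem hx, Real.zero_rpow h1'.ne', zero_mul]
      exact Set.indicator_nonneg (fun x _ => hH.nonneg x) _

/-- The density of the image of `H dx` under the `i`-th coordinate. -/
noncomputable def marginal {k : ℕ} (i : Fin (k + 1)) (H : (Fin (k + 1) → ℝ) → ℝ) (t : ℝ) : ℝ :=
  (∫⁻ z : Fin k → ℝ, ENNReal.ofReal (H (i.insertNth t z))).toReal

section marginal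

variable {k : ℕ} {H : (Fin (k + 1) → ℝ) → ℝ} {P : Set (Fin (k + 1) → ℝ)} (i : Fin (k + 1))

theorem exists_lintegral_insertNth_le (hH : IsLogConcaveDensity H) (hP : Bornology.IsBounded P)
    (hsupp : ∀ x, x ∉ P → H x = 0) :
    ∃ C : NNReal, ∀ t : ℝ, ∫⁻ z : Fin k → ℝ, ENNReal.ofReal (H (i.insertNth t z)) ≤ C := by
  obtain ⟨M, hM⟩ := hH.bounded
  obtain ⟨R, hR⟩ := hP.subset_closedBall 0
  have hfin : ENNReal.ofReal M * volume (Metric.closedBall (0 : Fin k → ℝ) R) ≠ ∞ :=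
    ENNReal.mul_ne_top ENNReal.ofReal_ne_top measure_closedBall_lt_top.ne
  refine ⟨(ENNReal.ofReal M * volume (Metric.closedBall (0 : Fin k → ℝ) R)).toNNReal, fun t => ?_⟩
  rw [ENNReal.coe_toNNReal hfin,
    ← lintegral_indicator_const Metric.isClosed_closedBall.measurableSet]
  refine lintegral_mono fun z => ?_
  by_cases hz : z ∈ Metric.closedBall (0 : Fin k → ℝ) R
  · rw [Set.indicator_of_mem hz]
    exact ENNReal.ofReal_le_ofReal (hM _)
  · rw [hsupp, ENNReal.ofReal_zero]
    · exact zero_le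
    intro hmem
    apply hz
    have h1 := hR hmem
    rw [mem_closedBall_zero_iff] at h1 ⊢
    have hR0 : 0 ≤ R := (norm_nonneg _).trans h1
    refine (pi_norm_le_iff_of_nonneg hR0).2 fun j => ?_
    have := (pi_norm_le_iff_of_nonneg hR0).1 h1 (i.succAbove j)
    simpa using this

theorem ofReal_marginal (hH : IsLogConcaveDensity H) (hP : Bornology.IsBounded P)
    (hsupp : ∀ x, x ∉ P → H x = 0) (t : ℝ) :
    ENNReal.ofReal (marginal i H t) =
      ∫⁻ z : Fin k → ℝ, ENNReal.ofReal (H (i.insertNth t z)) := by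
  obtain ⟨C, hC⟩ := exists_lintegral_insertNth_le i hH hP hsupp
  exact ENNReal.ofReal_toReal (ne_top_of_le_ne_top ENNReal.coe_ne_top (hC t))

theorem bddAbove_marginal (hH : IsLogConcaveDensity H) (hP : Bornology.IsBounded P)
    (hsupp : ∀ x, x ∉ P → H x = 0) : BddAbove (Set.range (marginal i H)) := by
  obtain ⟨C, hC⟩ := exists_lintegral_insertNth_le i hH hP hsupp
  refine ⟨C, ?_⟩
  rintro _ ⟨t, rfl⟩
  exact ENNReal.toReal_mono ENNReal.coe_ne_top (hC t)

theorem measurable_marginal (hH : IsLogConcaveDensity H) : Measurable (marginal i H) :=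
  (hH.measurable.comp
    (measurable_insertNth_uncurry i)).ennreal_ofReal.lintegral_prod_right'.ennreal_toReal

theorem logConcaveOnLine_marginal (hH : IsLogConcaveDensity H) (hP : Bornology.IsBounded P)
    (hsupp : ∀ x, x ∉ P → H x = 0) : LogConcaveOnLine (marginal i H) := by
  intro w h0 h1 s t
  have h1' : 0 < 1 - w := by linarith
  have key := lintegral_insertNth_logConcave i hH.measurable.ennreal_ofReal h0 h1
    (fun x y => by
      rw [ENNReal.ofReal_rpow_of_nonneg (hH.nonneg _) h1'.le,
        ENNReal.ofReal_rpow_of_nonneg (hH.nonneg _) h0.le,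
        ← ENNReal.ofReal_mul (Real.rpow_nonneg (hH.nonneg _) _)]
      exact ENNReal.ofReal_le_ofReal (hH.logConcave w h0 h1 x y)) s t
  obtain ⟨C, hC⟩ := exists_lintegral_insertNth_le i hH hP hsupp
  have := ENNReal.toReal_mono (ne_top_of_le_ne_top ENNReal.coe_ne_top (hC _)) key
  rwa [ENNReal.toReal_mul, ← ENNReal.toReal_rpow, ← ENNReal.toReal_rpow] at this

theorem lintegral_marginal (hH : IsLogConcaveDensity H) (hP : Bornology.IsBounded P)
    (hsupp : ∀ x, x ∉ P → H x = 0) {u : ℝ → ℝ≥0∞} (hu : Measurable u) :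
    ∫⁻ t, u t ∂(volume.withDensity fun t => ENNReal.ofReal (marginal i H t)) =
      ∫⁻ x, u (x i) ∂(volume.withDensity fun x => ENNReal.ofReal (H x)) := by
  have hui : Measurable fun x : Fin (k + 1) → ℝ => u (x i) := hu.comp (measurable_pi_apply i)
  rw [lintegral_withDensity_eq_lintegral_mul _ (measurable_marginal i hH).ennreal_ofReal hu,
    lintegral_withDensity_eq_lintegral_mul _ hH.measurable.ennreal_ofReal hui,
    lintegral_fin_succ_eq i (hH.measurable.ennreal_ofReal.mul hui)]
  refine lintegral_congr fun t => ?_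
  simp only [Pi.mul_apply, Fin.insertNth_apply_same]
  rw [ofReal_marginal i hH hP hsupp, lintegral_mul_const]
  exact (hH.measurable.comp ((measurable_insertNth_uncurry i).comp
    (measurable_const.prodMk measurable_id))).ennreal_ofReal

end marginal

/-! ### The product bound, by reduction from thin pieces to the line -/

/-- A Remez inequality with exponent `d` on all segments of `V`. -/
def RemezOnSegments {k : ℕ} (F : (Fin k → ℝ) → ℝ) (d : ℝ) (V : Set (Fin k → ℝ)) : Prop :=
  ∀ p q : Fin k → ℝ, p ≠ q → ∀ α β, (∀ t ∈ Set.Icc α β, AffineMap.lineMap p q t ∈ V) →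
    RemezOnInterval (fun t => F (AffineMap.lineMap p q t)) d α β

theorem RemezOnInterval.congr {g g' : ℝ → ℝ} {d α β : ℝ} (h : RemezOnInterval g d α β)
    (hgg : ∀ t ∈ Set.Icc α β, g t = g' t) : RemezOnInterval g' d α β := by
  intro c e hc hce he ω hω hωm hω0 L hL x hx
  have hsub : Set.Icc c e ⊆ Set.Icc α β := Set.Icc_subset_Icc hc he
  rw [← hgg x (hsub hx)]
  exact h c e hc hce he ω hω hωm hω0 L (fun z hz => by
    rw [hgg z (hsub (hω hz))]; exact hL z hz) x hx

/-- A compact convex set contains a segment spanning its range of `i`-th coordinates. -/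
theorem exists_spanning_segment {k : ℕ} {P : Set (Fin k → ℝ)} (hPc : IsCompact P)
    (hPx : Convex ℝ P) (hPne : P.Nonempty) {i : Fin k} (hni : ∃ x ∈ P, ∃ y ∈ P, x i ≠ y i) :
    ∃ p q : Fin k → ℝ, p ≠ q ∧ ∃ α β, (∀ x ∈ P, x i ∈ Set.Icc α β) ∧
      (∀ t ∈ Set.Icc α β, AffineMap.lineMap p q t ∈ P) ∧
      ∀ t : ℝ, (AffineMap.lineMap p q t : Fin k → ℝ) i = t := by
  obtain ⟨a, ha, hmin⟩ := hPc.exists_isMinOn hPne (continuous_apply i).continuousOn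
  obtain ⟨b, hb, hmax⟩ := hPc.exists_isMaxOn hPne (continuous_apply i).continuousOn
  have hmin' : ∀ x ∈ P, a i ≤ x i := fun x hx => hmin hx
  have hmax' : ∀ x ∈ P, x i ≤ b i := fun x hx => hmax hx
  have hab : a i < b i := by
    obtain ⟨x, hx, y, hy, hxy⟩ := hni
    rcases lt_or_gt_of_ne hxy with h | h
    · linarith [hmin' x hx, hmax' y hy]
    · linarith [hmin' y hy, hmax' x hx]
  have hab' : b i - a i ≠ 0 := by linarith
  -- The line through a and b is parametrized by its own `i`-th coordinate, the variable of the
  -- marginal.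
  set p := a - (a i / (b i - a i)) • (b - a) with hp
  set q := p + (1 / (b i - a i)) • (b - a) with hq
  have hline : ∀ t : ℝ, (AffineMap.lineMap p q t : Fin k → ℝ) =
      a + ((t - a i) / (b i - a i)) • (b - a) := by
    intro t
    rw [AffineMap.lineMap_apply, vsub_eq_sub, vadd_eq_add, hq, add_sub_cancel_left, hp, smul_smul]
    ext j
    simp only [Pi.add_apply, Pi.sub_apply, Pi.smul_apply, smul_eq_mul]
    ring
  have hcoord : ∀ t : ℝ, (AffineMap.lineMap p q t : Fin k → ℝ) i = t := by
    intro t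
    rw [hline]
    simp only [Pi.add_apply, Pi.sub_apply, Pi.smul_apply, smul_eq_mul]
    field_simp
    ring
  refine ⟨p, q, fun hpq => ?_, a i, b i, fun x hx => ⟨hmin' x hx, hmax' x hx⟩, fun t ht => ?_,
    hcoord⟩
  · have h0 := hcoord 0
    have h1 := hcoord 1
    rw [hpq] at h0 h1
    simp only [AffineMap.lineMap_same_apply] at h0 h1
    linarith
  · rw [hline]
    have hpos : 0 < b i - a i := by linarith
    refine hPx.add_smul_sub_mem ha hb ⟨div_nonneg (by linarith [ht.1]) hpos.le, ?_⟩
    rw [div_le_one hpos]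
    linarith [ht.2]

theorem lintegral_le_of_abs_sub_le {X : Type*} [MeasurableSpace X] {μ : Measure X} {P : Set X}
    (hP : MeasurableSet P) {u v : X → ℝ} (hv : Measurable v) {η : ℝ}
    (h : ∀ x ∈ P, u x ≤ v x + η) :
    ∫⁻ x in P, ENNReal.ofReal (u x) ∂μ ≤
      (∫⁻ x in P, ENNReal.ofReal (v x) ∂μ) + ENNReal.ofReal η * μ P := by
  rw [← setLIntegral_const, ← lintegral_add_left hv.ennreal_ofReal]
  exact setLIntegral_mono' hP fun x hx =>
    (ENNReal.ofReal_le_ofReal (h x hx)).trans ENNReal.ofReal_add_le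

theorem const_mul_le_lintegral {X : Type*} [MeasurableSpace X] {μ : Measure X} {P : Set X}
    {u : X → ℝ} {c : ℝ} (hu : IntegrableOn u P μ) (hu0 : 0 ≤ᵐ[μ.restrict P] u) (hμP : μ P ≠ ∞)
    (hc : 0 ≤ c) (h : 0 < ∫ x in P, (u x - c) ∂μ) :
    ENNReal.ofReal c * μ P ≤ ∫⁻ x in P, ENNReal.ofReal (u x) ∂μ := by
  rw [← ofReal_integral_eq_lintegral_ofReal hu hu0]
  have hci : IntegrableOn (fun _ : X => c) P μ := integrableOn_const hμP
  rw [integral_sub hu hci, setIntegral_const, smul_eq_mul] at h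
  rw [← ENNReal.ofReal_toReal hμP, ← ENNReal.ofReal_mul hc]
  refine ENNReal.ofReal_le_ofReal ?_
  rw [Measure.real] at h
  linarith

theorem le_add_of_lintegral_bounds {m₀ X : ℝ≥0∞} (h0 : m₀ ≠ 0) (ht : m₀ ≠ ∞) {c η K : ℝ}
    (hη : 0 ≤ η) (hK : 0 ≤ K) (h1 : ENNReal.ofReal c * m₀ ≤ X + ENNReal.ofReal η * m₀)
    (h2 : X ≤ ENNReal.ofReal K * m₀) : c ≤ K + η := by
  have h3 : ENNReal.ofReal c * m₀ ≤ ENNReal.ofReal (K + η) * m₀ := by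
    rw [ENNReal.ofReal_add hK hη, add_mul]
    exact h1.trans (add_le_add_left h2 _)
  exact (ENNReal.ofReal_le_ofReal_iff (by positivity)).1 ((ENNReal.mul_le_mul_iff_left h0 ht).1 h3)

theorem IsLogConcaveDensity.isFiniteMeasureOnCompacts {k : ℕ} {H : (Fin k → ℝ) → ℝ}
    (hH : IsLogConcaveDensity H) :
    IsFiniteMeasureOnCompacts (volume.withDensity fun x => ENNReal.ofReal (H x)) := by
  obtain ⟨M, hM⟩ := hH.bounded
  refine ⟨fun K hK => ?_⟩
  rw [withDensity_apply _ hK.measurableSet]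
  calc _ ≤ ∫⁻ _ in K, ENNReal.ofReal M :=
        lintegral_mono fun x => ENNReal.ofReal_le_ofReal (hM x)
    _ = ENNReal.ofReal M * volume K := setLIntegral_const _ _
    _ < ∞ := ENNReal.mul_lt_top ENNReal.ofReal_lt_top hK.measure_lt_top

theorem withDensity_indicator_eq_restrict {k : ℕ} (H : (Fin k → ℝ) → ℝ) {P : Set (Fin k → ℝ)}
    (hP : MeasurableSet P) :
    (volume.withDensity fun x => ENNReal.ofReal (P.indicator H x)) =
      (volume.withDensity fun x => ENNReal.ofReal (H x)).restrict P := by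
  rw [restrict_withDensity hP, ← withDensity_indicator hP]
  congr 1
  ext x
  by_cases hx : x ∈ P <;> simp [hx]

/-- The bound on the positive moment of a function with Remez exponent `d`, relative to its
level. -/
noncomputable def momentBound (m d : ℝ) : ℝ :=
  4 ^ (m * d) * (Real.exp 1 * Real.Gamma (m * d + 1))

/-- The bound on the negative moment of a function with Remez exponent `d`, relative to its
level. -/
noncomputable def negMomentBound (p d : ℝ) : ℝ :=
  4 ^ (p * d) * (2 * Real.exp 1 / (1 - p * d))

theorem mul_rpow_le_of_level {A B K₁ K₂ S m n p q : ℝ} (hA : 0 ≤ A) (hB : 0 ≤ B) (hK₁ : 0 ≤ K₁)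
    (hK₂ : 0 ≤ K₂) (hS : 0 < S) (hn : 0 < n) (hq : 0 < q) (hmnpq : m * n = p * q)
    (h₁ : A ≤ S ^ m * K₁) (h₂ : B ≤ S ^ (-p) * K₂) : A ^ n * B ^ q ≤ K₁ ^ n * K₂ ^ q := by
  calc A ^ n * B ^ q ≤ (S ^ m * K₁) ^ n * (S ^ (-p) * K₂) ^ q := by gcongr
    _ = S ^ (m * n) * S ^ (-p * q) * (K₁ ^ n * K₂ ^ q) := by
        rw [Real.mul_rpow (by positivity) hK₁, Real.mul_rpow (by positivity) hK₂,
          ← Real.rpow_mul hS.le, ← Real.rpow_mul hS.le]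
        ring
    _ = K₁ ^ n * K₂ ^ q := by
        rw [← Real.rpow_add hS, hmnpq, neg_mul, add_neg_cancel, Real.rpow_zero, one_mul]

section product

variable {k : ℕ} {H F : (Fin (k + 1) → ℝ) → ℝ} {V : Set (Fin (k + 1) → ℝ)} {d : ℝ}

/-- On a thin positive piece, both powers of `F` exceed the same powers of a function of one
coordinate by at most η, while their averages there are at least `c₁` and `c₂`. The one-dimensional
moment bounds, with the marginal as weight, then share one level `S`, which cancels. -/
theorem product_bound_of_integral_sub_pos (hH : IsLogConcaveDensity H) (hVc : IsCompact V)
    (hVx : Convex ℝ V) (hF : ContinuousOn F V) (hF0 : ∀ x, 0 ≤ F x) (hd : 0 < d)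
    (hR : RemezOnSegments F d V) {m n p q ε c₁ c₂ η : ℝ} (hm : 0 < m) (hn : 0 < n) (hp : 0 < p)
    (hq : 0 < q) (hmnpq : m * n = p * q) (hpd : p * d < 1) (hε : 0 < ε) (hη : 0 < η)
    (hη₁ : η < c₁) (hη₂ : η < c₂)
    (h₁ : 0 < ∫ x in V, (F x ^ m - c₁) ∂(volume.withDensity fun x => ENNReal.ofReal (H x)))
    (h₂ : 0 < ∫ x in V, ((F x + ε) ^ (-p) - c₂)
      ∂(volume.withDensity fun x => ENNReal.ofReal (H x))) :
    (c₁ - η) ^ n * (c₂ - η) ^ q ≤ momentBound m d ^ n * negMomentBound p d ^ q := by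
  set μ := volume.withDensity fun x => ENNReal.ofReal (H x) with hμ
  have := hH.isFiniteMeasureOnCompacts
  have hμac : μ ≪ volume := withDensity_absolutelyContinuous _ _
  have hF₁ : ContinuousOn (fun x => F x ^ m) V :=
    hF.rpow_const fun x _ => Or.inr hm.le
  have hFε : ∀ x, 0 < F x + ε := fun x => by linarith [hF0 x]
  have hF₂ : ContinuousOn (fun x => (F x + ε) ^ (-p)) V :=
    (hF.add continuousOn_const).rpow_const fun x _ => Or.inl (hFε x).ne'
  obtain ⟨δ₁, hδ₁, hu₁⟩ := Metric.uniformContinuousOn_iff.1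
    (hVc.uniformContinuousOn_of_continuous hF₁) η hη
  obtain ⟨δ₂, hδ₂, hu₂⟩ := Metric.uniformContinuousOn_iff.1
    (hVc.uniformContinuousOn_of_continuous hF₂) η hη
  obtain ⟨P, i, hP, hthin⟩ := IsPositivePiece.exists_thin hμac
    ((hF₁.sub continuousOn_const).integrableOn_compact hVc)
    ((hF₂.sub continuousOn_const).integrableOn_compact hVc)
    ⟨hVc, hVx, subset_rfl, h₁, h₂⟩ (half_pos (lt_min hδ₁ hδ₂))
  have hPc := hP.isCompact
  have hPm := hPc.measurableSet
  have hPV := hP.subset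
  have hμP0 : μ P ≠ 0 := by
    intro h0
    have := hP.pos₁
    rw [Measure.restrict_eq_zero.2 h0, integral_zero_measure] at this
    exact lt_irrefl _ this
  have hμPt : μ P ≠ ∞ := hPc.measure_lt_top.ne
  have hPne : P.Nonempty := by
    rw [Set.nonempty_iff_ne_empty]
    rintro rfl
    exact hμP0 measure_empty
  have hni : ∃ x ∈ P, ∃ y ∈ P, x i ≠ y i := by
    by_contra! hcon
    obtain ⟨x, hx⟩ := hPne
    refine hμP0 (hμac (measure_mono_null (t := {y | y i = x i}) (fun y hy => hcon y hy x hx) ?_))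
    exact Measure.pi_hyperplane (α := fun _ => ℝ) (fun _ => volume) i (x i)
  obtain ⟨a, b, hab, α, β, hPI, hIP, hcoord⟩ := exists_spanning_segment hPc hP.convex hPne hni
  have hαβ : α ≤ β := by
    obtain ⟨x, hx⟩ := hPne
    exact (hPI x hx).1.trans (hPI x hx).2
  -- Clamping extends `F` on the spanning segment to a continuous function on the whole line.
  set clamp : ℝ → ℝ := fun t => max α (min β t) with hclamp
  have hclampI : ∀ t, clamp t ∈ Set.Icc α β := fun t =>
    ⟨le_max_left _ _, max_le hαβ (min_le_left _ _)⟩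
  have hclamp_eq : ∀ t ∈ Set.Icc α β, clamp t = t := fun t ht => by
    simp only [hclamp]
    rw [min_eq_right ht.2, max_eq_right ht.1]
  set g : ℝ → ℝ := fun t => F (AffineMap.lineMap a b (clamp t)) with hg
  have hgc : Continuous g := by
    refine hF.comp_continuous ?_ fun t => hPV (hIP _ (hclampI t))
    exact AffineMap.lineMap_continuous.comp (by fun_prop)
  have hg0 : ∀ t, 0 ≤ g t := fun t => hF0 _
  have hgP : ∀ x ∈ P, ∃ y ∈ P, g (x i) = F y ∧ dist x y < min δ₁ δ₂ := by
    intro x hx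
    refine ⟨AffineMap.lineMap a b (x i), hIP _ (hPI x hx), ?_, ?_⟩
    · simp only [hg]
      rw [hclamp_eq _ (hPI x hx)]
    · rw [dist_eq_norm]
      have := hthin x hx _ (hIP _ (hPI x hx)) (hcoord _).symm
      linarith [half_lt_self (lt_min hδ₁ hδ₂)]
  have near₁ : ∀ x ∈ P, F x ^ m ≤ g (x i) ^ m + η := by
    intro x hx
    obtain ⟨y, hy, hxy, hdist⟩ := hgP x hx
    have := hu₁ x (hPV hx) y (hPV hy) (hdist.trans_le (min_le_left _ _))
    rw [Real.dist_eq] at this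
    rw [hxy]
    linarith [(abs_lt.1 this).2]
  have near₂ : ∀ x ∈ P, (F x + ε) ^ (-p) ≤ (g (x i) + ε) ^ (-p) + η := by
    intro x hx
    obtain ⟨y, hy, hxy, hdist⟩ := hgP x hx
    have := hu₂ x (hPV hx) y (hPV hy) (hdist.trans_le (min_le_right _ _))
    rw [Real.dist_eq] at this
    rw [hxy]
    linarith [(abs_lt.1 this).2]
  have hi : Measurable fun x : Fin (k + 1) → ℝ => x i := measurable_pi_apply i
  have up₁ := lintegral_le_of_abs_sub_le (μ := μ) hPm
    ((hgc.measurable.comp hi).pow_const m) near₁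
  have up₂ := lintegral_le_of_abs_sub_le (μ := μ) hPm
    (((hgc.measurable.comp hi).add_const ε).pow_const (-p)) near₂
  have low₁ := const_mul_le_lintegral ((hF₁.mono hPV).integrableOn_compact hPc)
    (.of_forall fun x => Real.rpow_nonneg (hF0 x) m) hμPt (hη.trans hη₁).le hP.pos₁
  have low₂ := const_mul_le_lintegral ((hF₂.mono hPV).integrableOn_compact hPc)
    (.of_forall fun x => Real.rpow_nonneg (hFε x).le (-p)) hμPt (hη.trans hη₂).le hP.pos₂
  -- If `g` vanished on [α, β], then F^m ≤ η on `P`, contradicting an average of at least c₁ > η.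
  have hgpos : ∃ t ∈ Set.Icc α β, 0 < g t := by
    by_contra! hcon
    have hz : ∀ x ∈ P, F x ^ m ≤ 0 + η := fun x hx => by
      have := near₁ x hx
      rwa [le_antisymm (hcon _ (hPI x hx)) (hg0 _), Real.zero_rpow hm.ne'] at this
    have := lintegral_le_of_abs_sub_le (μ := μ) hPm (measurable_const (a := (0 : ℝ))) hz
    have := le_add_of_lintegral_bounds hμP0 hμPt hη.le le_rfl (low₁.trans this)
      (K := 0) (by simp)
    linarith
  set G := P.indicator H with hG
  have hGd : IsLogConcaveDensity G := hH.indicator hPm hP.convex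
  have hGsupp : ∀ x, x ∉ P → G x = 0 := fun x hx => Set.indicator_of_notMem hx _
  have hPb := hPc.isBounded
  have hGμ : (volume.withDensity fun x => ENNReal.ofReal (G x)) = μ.restrict P :=
    withDensity_indicator_eq_restrict H hPm
  have hmarg : ∀ {u : ℝ → ℝ≥0∞}, Measurable u →
      ∫⁻ t, u t ∂(volume.withDensity fun t => ENNReal.ofReal (marginal i G t)) =
        ∫⁻ x in P, u (x i) ∂μ := fun hu => by
    rw [lintegral_marginal i hGd hPb hGsupp hu, hGμ]
  have hI : ∫⁻ t, ENNReal.ofReal (marginal i G t) = μ P := by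
    have := hmarg (u := fun _ => 1) measurable_const
    rw [lintegral_one, withDensity_apply _ MeasurableSet.univ, Measure.restrict_univ,
      setLIntegral_one] at this
    exact this
  have hmsupp : ∀ t, t ∉ Set.Icc α β → marginal i G t = 0 := by
    intro t ht
    have hz : ∀ z : Fin k → ℝ, ENNReal.ofReal (G (i.insertNth t z)) = 0 := fun z => by
      rw [hGsupp, ENNReal.ofReal_zero]
      intro hmem
      apply ht
      simpa using hPI _ hmem
    simp [marginal, hz]
  have hRg : RemezOnInterval g d α β :=
    (hR a b hab α β fun t ht => hPV (hIP t ht)).congr fun t ht => by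
      simp only [hg]
      rw [hclamp_eq t ht]
  obtain ⟨S, hS, hmom, hneg⟩ := exists_level_moments
    (logConcaveOnLine_marginal i hGd hPb hGsupp) (fun t => ENNReal.toReal_nonneg)
    (measurable_marginal i hGd) (bddAbove_marginal i hGd hPb hGsupp) hmsupp
    (by rw [hI]; exact hμP0) hgc hg0 hgpos hd hRg hm hp hpd
  have hneg := hneg ε hε
  rw [hI, hmarg (hgc.measurable.pow_const m).ennreal_ofReal] at hmom
  rw [hI, hmarg ((hgc.measurable.add_const ε).pow_const (-p)).ennreal_ofReal] at hneg
  have hK₁ : 0 ≤ momentBound m d := by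
    have := Real.Gamma_pos_of_pos (show 0 < m * d + 1 by positivity)
    unfold momentBound
    positivity
  have hK₂ : 0 ≤ negMomentBound p d := by
    have : 0 < 1 - p * d := by linarith
    unfold negMomentBound
    positivity
  have fin₁ := le_add_of_lintegral_bounds hμP0 hμPt hη.le
    (mul_nonneg (Real.rpow_nonneg hS.le m) hK₁) (low₁.trans up₁) hmom
  have fin₂ := le_add_of_lintegral_bounds hμP0 hμPt hη.le
    (mul_nonneg (Real.rpow_nonneg hS.le (-p)) hK₂) (low₂.trans up₂) hneg
  exact mul_rpow_le_of_level (by linarith) (by linarith) hK₁ hK₂ hS hn hq hmnpq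
    (by linarith) (by linarith)

/-- Localization needs strictly positive integrals, so the averages are lowered by η; a second η is
lost to the thinness of the piece, and then η → 0. -/
theorem product_bound_real (hH : IsLogConcaveDensity H) (hVc : IsCompact V)
    (hVx : Convex ℝ V) (hF : ContinuousOn F V) (hF0 : ∀ x, 0 ≤ F x) (hd : 0 < d)
    (hR : RemezOnSegments F d V) {m n p q ε A B : ℝ} (hm : 0 < m) (hn : 0 < n) (hp : 0 < p)
    (hq : 0 < q) (hmnpq : m * n = p * q) (hpd : p * d < 1) (hε : 0 < ε) (hA : 0 < A) (hB : 0 < B)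
    (hμV : (volume.withDensity fun x => ENNReal.ofReal (H x)) V ≠ 0)
    (h₁ : ∫ x in V, F x ^ m ∂(volume.withDensity fun x => ENNReal.ofReal (H x)) =
      A * (volume.withDensity fun x => ENNReal.ofReal (H x)).real V)
    (h₂ : ∫ x in V, (F x + ε) ^ (-p) ∂(volume.withDensity fun x => ENNReal.ofReal (H x)) =
      B * (volume.withDensity fun x => ENNReal.ofReal (H x)).real V) :
    A ^ n * B ^ q ≤ momentBound m d ^ n * negMomentBound p d ^ q := by
  set μ := volume.withDensity fun x => ENNReal.ofReal (H x) with hμ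
  have := hH.isFiniteMeasureOnCompacts
  have hμV' : 0 < μ.real V := ENNReal.toReal_pos hμV hVc.measure_lt_top.ne
  have hF₁ : ContinuousOn (fun x => F x ^ m) V := hF.rpow_const fun x _ => Or.inr hm.le
  have hF₂ : ContinuousOn (fun x => (F x + ε) ^ (-p)) V :=
    (hF.add continuousOn_const).rpow_const fun x _ => Or.inl (show F x + ε ≠ 0 by linarith [hF0 x])
  have sub : ∀ {u : (Fin (k + 1) → ℝ) → ℝ} {D η : ℝ}, ContinuousOn u V → 0 < η →
      ∫ x in V, u x ∂μ = D * μ.real V → 0 < ∫ x in V, (u x - (D - η)) ∂μ := by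
    intro u D η hu hη hD
    rw [integral_sub (hu.integrableOn_compact hVc) (integrableOn_const hVc.measure_lt_top.ne),
      setIntegral_const, hD, smul_eq_mul]
    nlinarith
  have T : Filter.Tendsto (fun η : ℝ => (A - η - η) ^ n * (B - η - η) ^ q)
      (nhdsWithin 0 (Set.Ioi 0)) (nhds (A ^ n * B ^ q)) := by
    refine Filter.Tendsto.mono_left ?_ nhdsWithin_le_nhds
    have : ContinuousAt (fun η : ℝ => (A - η - η) ^ n * (B - η - η) ^ q) 0 := by
      refine ContinuousAt.mul ?_ ?_
      · exact ContinuousAt.rpow_const (by fun_prop) (Or.inr hn.le)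
      · exact ContinuousAt.rpow_const (by fun_prop) (Or.inr hq.le)
    simpa [ContinuousAt] using this
  refine le_of_tendsto T ?_
  filter_upwards [Ioo_mem_nhdsGT (show 0 < min A B / 2 by positivity)] with η hη
  have l₁ := min_le_left A B
  have l₂ := min_le_right A B
  exact product_bound_of_integral_sub_pos hH hVc hVx hF hF0 hd hR hm hn hp hq hmnpq hpd hε hη.1
    (by linarith [hη.2]) (by linarith [hη.2]) (sub hF₁ hη.1 h₁) (sub hF₂ hη.1 h₂)

end product

/-- Monotone convergence removes the shift that keeps the negative power continuous at zeros of `F`;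
the limit is ∞ at those zeros. -/
theorem iSup_lintegral_rpow_neg {X : Type*} [MeasurableSpace X] {μ : Measure X} {F : X → ℝ}
    (hF : AEMeasurable F μ) (hF0 : ∀ x, 0 ≤ F x) {p : ℝ} (hp : 0 < p) :
    ∫⁻ x, ENNReal.ofReal (F x) ^ (-p) ∂μ =
      ⨆ j : ℕ, ∫⁻ x, ENNReal.ofReal ((F x + 1 / ((j : ℝ) + 1)) ^ (-p)) ∂μ := by
  have hpos : ∀ (j : ℕ) x, 0 < F x + 1 / ((j : ℝ) + 1) := fun j x =>
    add_pos_of_nonneg_of_pos (hF0 x) (by positivity)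
  have hmono : ∀ x, Monotone fun j : ℕ =>
      ENNReal.ofReal ((F x + 1 / ((j : ℝ) + 1)) ^ (-p)) := fun x i j hij => by
    refine ENNReal.ofReal_le_ofReal (Real.rpow_le_rpow_of_nonpos (hpos j x) ?_ (by linarith))
    gcongr
  rw [← lintegral_iSup' (fun j => ((hF.add_const _).pow_const _).ennreal_ofReal)
    (.of_forall hmono)]
  refine lintegral_congr fun x => (iSup_eq_of_tendsto (hmono x) ?_).symm
  simp_rw [← ENNReal.ofReal_rpow_of_pos (hpos _ x)]
  refine (ENNReal.continuous_rpow_const.tendsto _).comp ?_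
  refine (ENNReal.continuous_ofReal.tendsto _).comp ?_
  simpa using tendsto_one_div_add_atTop_nhds_zero_nat.const_add (F x)

/-- The product bound for log-concave densities on `ℝ ^ (k + 1)`. -/
theorem product_bound_lintegral {k : ℕ} {H F : (Fin (k + 1) → ℝ) → ℝ} {V : Set (Fin (k + 1) → ℝ)}
    {d : ℝ} (hH : IsLogConcaveDensity H) (hVc : IsCompact V)
    (hVx : Convex ℝ V) (hF : ContinuousOn F V) (hF0 : ∀ x, 0 ≤ F x) (hd : 0 < d)
    (hR : RemezOnSegments F d V) {m n p q : ℝ} (hm : 0 < m) (hn : 0 < n) (hp : 0 < p)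
    (hq : 0 < q) (hmnpq : m * n = p * q) (hpd : p * d < 1)
    (hμV : (volume.withDensity fun x => ENNReal.ofReal (H x)) V ≠ 0) :
    (((volume.withDensity fun x => ENNReal.ofReal (H x)) V)⁻¹ * ∫⁻ x in V, ENNReal.ofReal (F x) ^ m
        ∂(volume.withDensity fun x => ENNReal.ofReal (H x))) ^ n *
      (((volume.withDensity fun x => ENNReal.ofReal (H x)) V)⁻¹ *
        ∫⁻ x in V, ENNReal.ofReal (F x) ^ (-p)
          ∂(volume.withDensity fun x => ENNReal.ofReal (H x))) ^ q ≤
      ENNReal.ofReal (momentBound m d ^ n * negMomentBound p d ^ q) := by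
  set μ := volume.withDensity fun x => ENNReal.ofReal (H x) with hμ
  have := hH.isFiniteMeasureOnCompacts
  have hμVt : μ V ≠ ∞ := hVc.measure_lt_top.ne
  have hμVr : 0 < μ.real V := ENNReal.toReal_pos hμV hμVt
  have hF₁ : ContinuousOn (fun x => F x ^ m) V := hF.rpow_const fun x _ => Or.inr hm.le
  have hFε : ∀ ε : ℝ, 0 < ε → ContinuousOn (fun x => (F x + ε) ^ (-p)) V := fun ε hε =>
    (hF.add continuousOn_const).rpow_const fun x _ =>
      Or.inl (show F x + ε ≠ 0 by linarith [hF0 x])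
  have avg : ∀ {u : (Fin (k + 1) → ℝ) → ℝ}, ContinuousOn u V → (∀ x, 0 ≤ u x) →
      (μ V)⁻¹ * ∫⁻ x in V, ENNReal.ofReal (u x) ∂μ =
        ENNReal.ofReal ((∫ x in V, u x ∂μ) / μ.real V) := fun hu hu0 => by
    rw [← ofReal_integral_eq_lintegral_ofReal (hu.integrableOn_compact hVc) (.of_forall hu0),
      ENNReal.ofReal_div_of_pos hμVr, Measure.real, ENNReal.ofReal_toReal hμVt, mul_comm,
      div_eq_mul_inv]
  rw [iSup_lintegral_rpow_neg (hF.aemeasurable hVc.measurableSet) hF0 hp, ENNReal.mul_iSup]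
  have hconst : (μ V)⁻¹ * ∫⁻ x in V, ENNReal.ofReal (F x) ^ m ∂μ =
      ⨆ _ : ℕ, (μ V)⁻¹ * ∫⁻ x in V, ENNReal.ofReal (F x ^ m) ∂μ := by
    rw [iSup_const]
    simp_rw [ENNReal.ofReal_rpow_of_nonneg (hF0 _) hm.le]
  rw [hconst]
  refine ENNReal.iSup_rpow_mul_iSup_rpow_le monotone_const ?_ hn hq fun j => ?_
  · refine fun i j hij => mul_le_mul' le_rfl (lintegral_mono fun x => ?_)
    refine ENNReal.ofReal_le_ofReal (Real.rpow_le_rpow_of_nonpos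
      (add_pos_of_nonneg_of_pos (hF0 x) (by positivity)) ?_ (by linarith))
    gcongr
  have hε : (0 : ℝ) < 1 / ((j : ℝ) + 1) := by positivity
  set ε : ℝ := 1 / ((j : ℝ) + 1)
  have nn₁ : ∀ x, 0 ≤ F x ^ m := fun x => Real.rpow_nonneg (hF0 x) m
  have nn₂ : ∀ x, 0 ≤ (F x + ε) ^ (-p) := fun x =>
    Real.rpow_nonneg (by linarith [hF0 x]) _
  rw [avg hF₁ nn₁, avg (hFε ε hε) nn₂]
  set A := (∫ x in V, F x ^ m ∂μ) / μ.real V with hA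
  set B := (∫ x in V, (F x + ε) ^ (-p) ∂μ) / μ.real V with hB
  have hA0 : 0 ≤ A := div_nonneg (integral_nonneg nn₁) hμVr.le
  have hB0 : 0 ≤ B := div_nonneg (integral_nonneg nn₂) hμVr.le
  rw [ENNReal.ofReal_rpow_of_nonneg hA0 hn.le, ENNReal.ofReal_rpow_of_nonneg hB0 hq.le,
    ← ENNReal.ofReal_mul (Real.rpow_nonneg hA0 _)]
  rcases hA0.eq_or_lt with h | hA'
  · rw [← h, Real.zero_rpow hn.ne', zero_mul, ENNReal.ofReal_zero]
    exact zero_le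
  rcases hB0.eq_or_lt with h | hB'
  · rw [← h, Real.zero_rpow hq.ne', mul_zero, ENNReal.ofReal_zero]
    exact zero_le
  exact ENNReal.ofReal_le_ofReal (product_bound_real hH hVc hVx hF hF0 hd hR hm hn hp hq hmnpq hpd
    hε hA' hB' hμV (div_mul_cancel₀ _ hμVr.ne').symm (div_mul_cancel₀ _ hμVr.ne').symm)

/-! ### Regularity of log-concave functions on Euclidean space -/

theorem IsLogConcave.rpow_mul_rpow_le {k : ℕ} {h : EuclideanSpace ℝ (Fin k) → ℝ}
    (hh : IsLogConcave h) {x y : EuclideanSpace ℝ (Fin k)} (hx : 0 < h x) (hy : 0 < h y) {w : ℝ}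
    (h0 : 0 ≤ w) (h1 : w ≤ 1) : h x ^ (1 - w) * h y ^ w ≤ h ((1 - w) • x + w • y) := by
  have hc := hh.2.2 (x := x) hx (y := y) hy (show 0 ≤ 1 - w by linarith) h0 (by ring)
  have hpos : 0 < h ((1 - w) • x + w • y) :=
    hh.2.1 (x := x) hx (y := y) hy (show 0 ≤ 1 - w by linarith) h0 (by ring)
  rw [← Real.log_le_log_iff (by positivity) hpos, Real.log_mul (by positivity) (by positivity),
    Real.log_rpow hx, Real.log_rpow hy]
  simpa using hc

theorem IsLogConcave.continuousOn_interior {k : ℕ} {h : EuclideanSpace ℝ (Fin k) → ℝ}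
    (hh : IsLogConcave h) : ContinuousOn h (interior {x | 0 < h x}) := by
  refine (Real.continuous_exp.comp_continuousOn hh.2.continuousOn_interior).congr fun x hx => ?_
  have : 0 < h x := interior_subset (s := {x | 0 < h x}) hx
  simp [Real.exp_log this]

/-- Around an interior point z the function is bounded below on a ball. Prolonging the segment from
y through z into that ball makes z a convex combination with a weight independent of y, so
log-concavity bounds h(y) through h(z). -/
theorem IsLogConcave.exists_le {k : ℕ} {h : EuclideanSpace ℝ (Fin k) → ℝ}
    (hh : IsLogConcave h) (hb : Bornology.IsBounded {x | 0 < h x})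
    (hne : (interior {x | 0 < h x}).Nonempty) : ∃ M, ∀ x, h x ≤ M := by
  obtain ⟨z, hz⟩ := hne
  obtain ⟨ρ, hρ, hball⟩ := Metric.nhds_basis_closedBall.mem_iff.1 (isOpen_interior.mem_nhds hz)
  obtain ⟨D, hD⟩ := hb.subset_closedBall z
  obtain ⟨y₀, hy₀, hmin⟩ := (isCompact_closedBall z ρ).exists_isMinOn
    ⟨z, Metric.mem_closedBall_self hρ.le⟩ (hh.continuousOn_interior.mono hball)
  have hc : 0 < h y₀ := interior_subset (s := {x | 0 < h x}) (hball hy₀)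
  have hz0 : 0 < h z := interior_subset (s := {x | 0 < h x}) hz
  set c := h y₀
  -- Small enough that z - s(y - z) stays in the ball of radius ρ for every y in the support.
  set s := ρ / (|D| + 1) with hs
  have hs0 : 0 < s := by positivity
  set w := s / (1 + s) with hw
  have hw0 : 0 < w := by positivity
  have hw1 : w < 1 := (div_lt_one (by positivity)).2 (by linarith)
  have h1w : 0 < 1 - w := by linarith
  refine ⟨(h z / c ^ (1 - w)) ^ (1 / w), fun y => ?_⟩
  rcases (hh.1 y).eq_or_lt with hy | hy
  · rw [← hy]
    positivity
  have hyD : ‖y - z‖ ≤ |D| := by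
    have := hD hy
    rw [Metric.mem_closedBall, dist_eq_norm] at this
    exact this.trans (le_abs_self D)
  set v := z - s • (y - z) with hv
  have hvball : v ∈ Metric.closedBall z ρ := by
    rw [Metric.mem_closedBall, dist_eq_norm, hv, sub_sub_cancel_left, norm_neg, norm_smul,
      Real.norm_of_nonneg hs0.le, hs, div_mul_eq_mul_div, div_le_iff₀ (by positivity)]
    gcongr
    linarith
  have hcv : c ≤ h v := hmin hvball
  have hcomb : (1 - w) • v + w • y = z := by
    have e1 : 1 - w = 1 / (1 + s) := by rw [hw]; field_simp; ring
    have e2 : (1 - w) * s = w := by rw [e1, hw]; ring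
    rw [hv, smul_sub, smul_smul, e2, smul_sub, sub_smul, one_smul]
    abel
  have key := hh.rpow_mul_rpow_le (hc.trans_le hcv) hy hw0.le hw1.le
  rw [hcomb] at key
  have h2 : h y ^ w ≤ h z / c ^ (1 - w) := by
    rw [le_div_iff₀ (by positivity), mul_comm]
    refine le_trans ?_ key
    gcongr
  calc h y = (h y ^ w) ^ (1 / w) := by
        rw [← Real.rpow_mul hy.le, mul_one_div_cancel hw0.ne', Real.rpow_one]
    _ ≤ _ := by gcongr

/-- A log-concave function of bounded support restricts to a bounded measurable log-concave density
on the interior of its support. -/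
theorem IsLogConcave.isLogConcaveDensity {k : ℕ} {h : EuclideanSpace ℝ (Fin k) → ℝ}
    (hh : IsLogConcave h) (hb : Bornology.IsBounded {x | 0 < h x}) :
    IsLogConcaveDensity fun x : Fin k → ℝ =>
      (interior {x | 0 < h x}).indicator h (WithLp.toLp 2 x) := by
  classical
  have hconv : Convex ℝ (interior {x | 0 < h x}) := hh.2.1.interior
  have hpos : ∀ {x}, x ∈ interior {x | 0 < h x} → 0 < h x := fun hx =>
    interior_subset (s := {x | 0 < h x}) hx
  refine ⟨?_, fun x => Set.indicator_nonneg (fun x _ => hh.1 x) _, ?_, ?_⟩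
  · have hm : Measurable ((interior {x | 0 < h x}).indicator h) := by
      rw [← Set.piecewise_eq_indicator]
      exact hh.continuousOn_interior.measurable_piecewise continuousOn_const
        isOpen_interior.measurableSet
    exact hm.comp (MeasurableEquiv.toLp 2 (Fin k → ℝ)).measurable
  · rcases (interior {x | 0 < h x}).eq_empty_or_nonempty with he | hne
    · exact ⟨0, fun x => by simp [he]⟩
    · obtain ⟨M, hM⟩ := hh.exists_le hb hne
      exact ⟨M, fun x => (Set.indicator_le_self' (fun _ _ => hh.1 _) _).trans (hM _)⟩
  · intro w h0 h1 x y
    have h1' : 0 < 1 - w := by linarith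
    by_cases hx : WithLp.toLp 2 x ∈ interior {x | 0 < h x}
    · by_cases hy : WithLp.toLp 2 y ∈ interior {x | 0 < h x}
      · have hxy := hconv hx hy h1'.le h0.le (by ring)
        rw [Set.indicator_of_mem hx, Set.indicator_of_mem hy, WithLp.toLp_add, WithLp.toLp_smul,
          WithLp.toLp_smul, Set.indicator_of_mem hxy]
        exact hh.rpow_mul_rpow_le (hpos hx) (hpos hy) h0.le h1.le
      · rw [Set.indicator_of_notMem hy, Real.zero_rpow h0.ne', mul_zero]
        exact Set.indicator_nonneg (fun x _ => hh.1 x) _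
    · rw [Set.indicator_of_notMem hx, Real.zero_rpow h1'.ne', zero_mul]
      exact Set.indicator_nonneg (fun x _ => hh.1 x) _

/-- Values on the boundary of the support do not affect the measure. -/
theorem IsLogConcave.densityMeasure_eq {k : ℕ} {h : EuclideanSpace ℝ (Fin k) → ℝ}
    (hh : IsLogConcave h) :
    densityMeasure h = densityMeasure ((interior {x | 0 < h x}).indicator h) := by
  refine withDensity_congr_ae ?_
  filter_upwards [compl_mem_ae_iff.2 (hh.2.1.addHaar_frontier volume)] with x hx
  by_cases hxi : x ∈ interior {x | 0 < h x}
  · rw [Set.indicator_of_mem hxi]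
  · rw [Set.indicator_of_notMem hxi]
    have : ¬ 0 < h x := fun h0 => hx ⟨subset_closure h0, hxi⟩
    rw [ENNReal.ofReal_zero, ENNReal.ofReal_eq_zero]
    exact not_lt.1 this

theorem measurePreserving_toLp_densityMeasure {k : ℕ} (h : EuclideanSpace ℝ (Fin k) → ℝ) :
    MeasurePreserving (WithLp.toLp 2 : (Fin k → ℝ) → EuclideanSpace ℝ (Fin k))
      (volume.withDensity fun x => ENNReal.ofReal (h (WithLp.toLp 2 x))) (densityMeasure h) := by
  have e := PiLp.volume_preserving_toLp (Fin k)
  refine ⟨e.measurable, Measure.ext fun s hs => ?_⟩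
  rw [Measure.map_apply e.measurable hs, withDensity_apply _ (e.measurable hs), densityMeasure,
    withDensity_apply _ hs]
  exact e.setLIntegral_comp_preimage_emb
    (MeasurableEquiv.toLp 2 (Fin k → ℝ)).measurableEmbedding (fun x => ENNReal.ofReal (h x)) s

theorem powerAverage_eq {k : ℕ} (h : EuclideanSpace ℝ (Fin k) → ℝ)
    (V : Set (EuclideanSpace ℝ (Fin k))) (g : EuclideanSpace ℝ (Fin k) → ℂ) (s : ℝ) :
    powerAverage (densityMeasure h) V g s =
      ((volume.withDensity fun x => ENNReal.ofReal (h (WithLp.toLp 2 x))) (WithLp.toLp 2 ⁻¹' V))⁻¹ *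
        ∫⁻ x in WithLp.toLp 2 ⁻¹' V, ENNReal.ofReal ‖g (WithLp.toLp 2 x)‖ ^ s
          ∂(volume.withDensity fun x => ENNReal.ofReal (h (WithLp.toLp 2 x))) := by
  have e := measurePreserving_toLp_densityMeasure h
  have he := (MeasurableEquiv.toLp 2 (Fin k → ℝ)).measurableEmbedding
  simp_rw [ofReal_norm]
  rw [e.setLIntegral_comp_preimage_emb he fun x => ‖g x‖ₑ ^ s, e.measure_preimage_emb he,
    powerAverage]

/-! ### Transfer to the ball, constants, and passage to the Chebyshev degree -/

/-- Remez exponents restrict to affinely parametrized segments. -/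
theorem IsRemezExponent.remezOnInterval {N : ℕ} {f : EuclideanSpace ℂ (Fin N) → ℂ} {d : ℝ}
    (hR : IsRemezExponent f d) (hd : 0 < d) {P Q : EuclideanSpace ℂ (Fin N)} (hPQ : P ≠ Q)
    {α β : ℝ} (hball : ∀ t ∈ Set.Icc α β, (AffineMap.lineMap P Q t : EuclideanSpace ℂ (Fin N)) ∈
      Metric.ball (0 : EuclideanSpace ℂ (Fin N)) 1) :
    RemezOnInterval (fun t => ‖f (AffineMap.lineMap P Q t)‖) d α β := by
  intro c e hc hce he ω hω hωm hω0 L hL x hx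
  have hinj : Function.Injective (AffineMap.lineMap P Q : ℝ → EuclideanSpace ℂ (Fin N)) :=
    AffineMap.lineMap_injective ℝ hPQ
  have hseg : segment ℝ (AffineMap.lineMap P Q c : EuclideanSpace ℂ (Fin N))
      (AffineMap.lineMap P Q e) = AffineMap.lineMap P Q '' Set.Icc c e := by
    rw [← segment_eq_Icc hce.le, image_segment]
  have hnn : (nndist P Q : ℝ≥0∞) ≠ 0 := by simpa using hPQ
  have hlen : ∀ s : Set ℝ, (μH[1] : Measure (EuclideanSpace ℂ (Fin N)))
      (AffineMap.lineMap P Q '' s) = nndist P Q * volume s := by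
    intro s
    rw [hausdorffMeasure_lineMap_image, hausdorffMeasure_real]
    rfl
  have hωt : volume ω ≠ ∞ := ne_top_of_le_ne_top (by simp) (measure_mono hω)
  have key := hR _ (hball c ⟨hc, hce.le.trans he⟩) _ (hball e ⟨hc.trans hce.le, he⟩)
    (AffineMap.lineMap P Q '' ω) (by rw [hseg]; exact Set.image_mono hω)
    (hωm.image_of_continuousOn_injOn (AffineMap.lineMap_continuous.continuousOn) hinj.injOn)
    (by rw [hlen]; exact mul_ne_zero hnn hω0)
  rw [hseg, hlen, hlen] at key
  have hωr : 0 < (volume ω).toReal := ENNReal.toReal_pos hω0 hωt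
  -- The parametrization multiplies all lengths by the distance from `P` to `Q`, which drops out of
  -- the ratio.
  have hratio : 4 * ((nndist P Q : ℝ≥0∞) * volume (Set.Icc c e)) / (nndist P Q * volume ω) =
      ENNReal.ofReal (4 * (e - c) / (volume ω).toReal) := by
    rw [mul_left_comm, ENNReal.mul_div_mul_left _ _ hnn ENNReal.coe_ne_top, Real.volume_Icc,
      ENNReal.ofReal_div_of_pos hωr, ENNReal.ofReal_toReal hωt, ENNReal.ofReal_mul (by norm_num)]
    norm_num
  obtain ⟨z₀, hz₀⟩ : ω.Nonempty := nonempty_of_measure_ne_zero hω0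
  have hL0 : 0 ≤ L := (norm_nonneg _).trans (hL z₀ hz₀)
  have hx' : ‖f (AffineMap.lineMap P Q x)‖ₑ ≤
      ENNReal.ofReal (4 * (e - c) / (volume ω).toReal) ^ d * ENNReal.ofReal L := by
    rw [← hratio]
    refine le_trans ?_ (key.trans ?_)
    · exact le_iSup₂ (f := fun z _ => ‖f z‖ₑ) _ (Set.mem_image_of_mem _ hx)
    · gcongr
      refine iSup₂_le ?_
      rintro _ ⟨z, hz, rfl⟩
      rw [← ofReal_norm]
      exact ENNReal.ofReal_le_ofReal (hL z hz)
  have hQ0 : 0 ≤ 4 * (e - c) / (volume ω).toReal := by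
    have : 0 < e - c := by linarith
    positivity
  rw [← ofReal_norm, ENNReal.ofReal_rpow_of_nonneg hQ0 hd.le,
    ← ENNReal.ofReal_mul (by positivity)] at hx'
  exact (ENNReal.ofReal_le_ofReal_iff (by positivity)).1 hx'

/-- The constant function 1 under a Dirac mass satisfies the exponential tail hypothesis with C = e,
and its moment is 1. -/
theorem one_le_exp_mul_Gamma {a : ℝ} (ha : 0 < a) : 1 ≤ Real.exp 1 * Real.Gamma (a + 1) := by
  have h := lintegral_rpow_le_of_exp_tail (ν := Measure.dirac ()) (u := fun _ => (1 : ℝ)) (I := 1)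
    measurable_const (fun _ => zero_le_one) ha (Real.exp_pos 1).le (fun t ht => by
      rcases lt_or_ge t 1 with h | h
      · refine prob_le_one.trans ?_
        rw [mul_one, ← Real.exp_add, ← ENNReal.ofReal_one]
        exact ENNReal.ofReal_le_ofReal (Real.one_le_exp (by linarith))
      · simp [not_lt.2 h])
  simpa using h

theorem one_le_momentBound {m d : ℝ} (hm : 0 < m) (hd : 0 < d) : 1 ≤ momentBound m d :=
  one_le_mul_of_one_le_of_one_le (Real.one_le_rpow (by norm_num) (by positivity))
    (one_le_exp_mul_Gamma (mul_pos hm hd))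

theorem one_le_negMomentBound {p d : ℝ} (hp : 0 < p) (hd : 0 < d) (hpd : p * d < 1) :
    1 ≤ negMomentBound p d := by
  refine one_le_mul_of_one_le_of_one_le (Real.one_le_rpow (by norm_num) (by positivity)) ?_
  rw [le_div_iff₀ (by linarith)]
  have := Real.one_le_exp (zero_le_one' ℝ)
  have : 0 < p * d := mul_pos hp hd
  linarith

/-- In dimension zero all averages are values at a single point. -/
theorem product_bound_of_subsingleton {X : Type*} [MeasurableSpace X] [Subsingleton X]
    (μ : Measure X) (V : Set X) (g : X → ℂ) {m n p q : ℝ} (hm : 0 < m)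
    (hn : 0 < n) (hq : 0 < q) (hmnpq : m * n = p * q) :
    ((μ V)⁻¹ * ∫⁻ x in V, ‖g x‖ₑ ^ m ∂μ) ^ n * ((μ V)⁻¹ * ∫⁻ x in V, ‖g x‖ₑ ^ (-p) ∂μ) ^ q ≤
      1 := by
  rcases isEmpty_or_nonempty X with hX | ⟨⟨x₀⟩⟩
  · simp [Measure.eq_zero_of_isEmpty μ, hn]
  have avg : ∀ s : ℝ, (μ V)⁻¹ * ∫⁻ x in V, ‖g x‖ₑ ^ s ∂μ ≤ ‖g x₀‖ₑ ^ s := by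
    intro s
    have : ∀ x, ‖g x‖ₑ ^ s = ‖g x₀‖ₑ ^ s := fun x => by rw [Subsingleton.elim x x₀]
    simp_rw [this]
    rw [setLIntegral_const, mul_left_comm]
    exact mul_le_of_le_one_right' (ENNReal.inv_mul_le_one _)
  calc _ ≤ (‖g x₀‖ₑ ^ m) ^ n * (‖g x₀‖ₑ ^ (-p)) ^ q := by
        gcongr
        · exact avg m
        · exact avg (-p)
    _ ≤ 1 := by
        rw [← ENNReal.rpow_mul, ← ENNReal.rpow_mul]
        by_cases h0 : ‖g x₀‖ₑ = 0
        · rw [h0, ENNReal.zero_rpow_of_pos (mul_pos hm hn), zero_mul]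
          exact zero_le
        · rw [← ENNReal.rpow_add _ _ h0 enorm_ne_top, hmnpq, neg_mul, add_neg_cancel,
            ENNReal.rpow_zero]

theorem powerAverage_product_le {N k : ℕ} (f : EuclideanSpace ℂ (Fin N) → ℂ)
    (hf : ContinuousOn f (Metric.ball (0 : EuclideanSpace ℂ (Fin N)) 1))
    (φ : EuclideanSpace ℝ (Fin k) →ᵃⁱ[ℝ] EuclideanSpace ℂ (Fin N))
    (V : Set (EuclideanSpace ℝ (Fin k)))
    (hVcompact : IsCompact V) (hVconvex : Convex ℝ V)
    (hVball : φ '' V ⊆ Metric.ball (0 : EuclideanSpace ℂ (Fin N)) 1)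
    (h : EuclideanSpace ℝ (Fin k) → ℝ) (hh : IsLogConcave h)
    (hsupp : Function.support h ⊆ V) (hmass : 0 < densityMeasure h V)
    {m n p q d : ℝ} (hm : 0 < m) (hn : 0 < n) (hp : 0 < p) (hq : 0 < q)
    (hmnpq : m * n = p * q) (hd : 0 < d) (hR : IsRemezExponent f d) (hpd : p * d < 1) :
    powerAverage (densityMeasure h) V (fun x => f (φ x)) m ^ n *
        powerAverage (densityMeasure h) V (fun x => f (φ x)) (-p) ^ q ≤
      ENNReal.ofReal (momentBound m d ^ n * negMomentBound p d ^ q) := by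
  -- Localization needs at least one coordinate. In dimension zero the product is at most 1, and so
  -- the constants must be at least 1.
  rcases k with _ | k
  · refine (product_bound_of_subsingleton (densityMeasure h) V (fun x => f (φ x)) hm hn hq
      hmnpq).trans ?_
    rw [← ENNReal.ofReal_one]
    exact ENNReal.ofReal_le_ofReal (one_le_mul_of_one_le_of_one_le
      (Real.one_le_rpow (one_le_momentBound hm hd) hn.le)
      (Real.one_le_rpow (one_le_negMomentBound hp hd hpd) hq.le))
  have hb : Bornology.IsBounded {x | 0 < h x} :=
    hVcompact.isBounded.subset fun x hx => hsupp (ne_of_gt hx)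
  have hH := hh.isLogConcaveDensity hb
  have he := (MeasurableEquiv.toLp 2 (Fin (k + 1) → ℝ)).measurableEmbedding
  rw [hh.densityMeasure_eq] at hmass ⊢
  rw [powerAverage_eq, powerAverage_eq]
  have hcont : Continuous (WithLp.toLp 2 : (Fin (k + 1) → ℝ) → EuclideanSpace ℝ (Fin (k + 1))) :=
    PiLp.continuous_toLp 2 _
  set V' : Set (Fin (k + 1) → ℝ) := WithLp.toLp 2 ⁻¹' V with hV'
  have hV'c : IsCompact V' :=
    (PiLp.homeomorph 2 fun _ : Fin (k + 1) => ℝ).symm.isCompact_preimage.2 hVcompact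
  have hV'x : Convex ℝ V' :=
    hVconvex.linear_preimage (WithLp.linearEquiv 2 ℝ (Fin (k + 1) → ℝ)).symm.toLinearMap
  have hmaps : ∀ x ∈ V', φ (WithLp.toLp 2 x) ∈ Metric.ball (0 : EuclideanSpace ℂ (Fin N)) 1 :=
    fun x hx => hVball (Set.mem_image_of_mem φ hx)
  refine product_bound_lintegral (F := fun x => ‖f (φ (WithLp.toLp 2 x))‖) hH hV'c hV'x ?_
    (fun x => norm_nonneg _) hd ?_ hm hn hp hq hmnpq hpd ?_
  · exact (hf.comp (φ.continuous.comp hcont).continuousOn hmaps).norm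
  · intro a b hab α β hI
    have hline : ∀ t : ℝ, φ (WithLp.toLp 2 (AffineMap.lineMap a b t)) =
        AffineMap.lineMap (φ (WithLp.toLp 2 a)) (φ (WithLp.toLp 2 b)) t := by
      intro t
      rw [show WithLp.toLp 2 (AffineMap.lineMap a b t : Fin (k + 1) → ℝ) =
          AffineMap.lineMap (WithLp.toLp 2 a : EuclideanSpace ℝ (Fin (k + 1)))
            (WithLp.toLp 2 b) t by
        simp [AffineMap.lineMap_apply]]
      exact φ.toAffineMap.apply_lineMap _ _ t
    simp_rw [hline]
    refine hR.remezOnInterval hd (fun hab' => hab ?_) fun t ht => ?_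
    · exact (WithLp.toLp_injective 2) (φ.injective hab')
    · rw [← hline]
      exact hmaps _ (hI t ht)
  · have e := measurePreserving_toLp_densityMeasure ((interior {x | 0 < h x}).indicator h)
    rw [hV', e.measure_preimage_emb he]
    exact hmass.ne'

/-- The positive moment only costs e^n; enlarging it to (2e)^n gives the symmetric form. -/
theorem momentBound_mul_negMomentBound_le {m n p q d : ℝ} (hn : 0 < n)
    (hm : 0 < m) (hd : 0 ≤ d) (hpd : p * d < 1) :
    momentBound m d ^ n * negMomentBound p d ^ q ≤
      (2 * Real.exp 1) ^ (n + q) * (4 : ℝ) ^ ((m * n + p * q) * d) *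
        (Real.Gamma (m * d + 1) ^ n / (1 - p * d) ^ q) := by
  have hG : 0 < Real.Gamma (m * d + 1) := Real.Gamma_pos_of_pos (by positivity)
  have h1 : 0 < 1 - p * d := by linarith
  have e0 : 0 < Real.exp 1 := Real.exp_pos 1
  unfold momentBound negMomentBound
  rw [Real.mul_rpow (by positivity) (by positivity), Real.mul_rpow (by positivity) (by positivity),
    Real.mul_rpow (by positivity) (by positivity), Real.div_rpow (by positivity) h1.le,
    ← Real.rpow_mul (by norm_num), ← Real.rpow_mul (by norm_num),
    Real.rpow_add (by positivity) n q,
    show (m * n + p * q) * d = m * d * n + p * d * q by ring, Real.rpow_add (by norm_num)]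
  have h2 : Real.exp 1 ^ n ≤ (2 * Real.exp 1) ^ n :=
    Real.rpow_le_rpow e0.le (by linarith) hn.le
  calc _ = Real.exp 1 ^ n * ((2 * Real.exp 1) ^ q * (4 ^ (m * d * n) * 4 ^ (p * d * q)) *
        (Real.Gamma (m * d + 1) ^ n / (1 - p * d) ^ q)) := by ring
    _ ≤ (2 * Real.exp 1) ^ n * ((2 * Real.exp 1) ^ q * (4 ^ (m * d * n) * 4 ^ (p * d * q)) *
        (Real.Gamma (m * d + 1) ^ n / (1 - p * d) ^ q)) := by gcongr
    _ = _ := by ring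

theorem continuousAt_momentBound_mul_negMomentBound {m n p q d : ℝ} (hm : 0 < m) (hn : 0 < n)
    (hq : 0 < q) (hd : 0 ≤ d) (hpd : p * d < 1) :
    ContinuousAt (fun d => momentBound m d ^ n * negMomentBound p d ^ q) d := by
  have hmd : 0 ≤ m * d := by positivity
  have hΓ : ContinuousAt (fun d => Real.Gamma (m * d + 1)) d := by
    have h0 : ContinuousAt Real.Gamma (m * d + 1) :=
      (Real.differentiableAt_Gamma fun j => by
        have : (0 : ℝ) ≤ j := j.cast_nonneg
        linarith).continuousAt
    exact ContinuousAt.comp (f := fun d => m * d + 1) h0 (by fun_prop)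
  have h4 : ∀ c : ℝ, ContinuousAt (fun d : ℝ => (4 : ℝ) ^ (c * d)) d := fun c =>
    ContinuousAt.rpow continuousAt_const (by fun_prop) (Or.inl (by norm_num))
  unfold momentBound negMomentBound
  refine ContinuousAt.mul ?_ ?_
  · exact ((h4 m).mul (continuousAt_const.mul hΓ)).rpow_const (Or.inr hn.le)
  · refine ((h4 p).mul (continuousAt_const.div (by fun_prop) ?_)).rpow_const (Or.inr hq.le)
    linarith

/-- The infimum may fail to be attained, and may be 0 although exponents are positive. Admissible
exponents arbitrarily close to it suffice, as the bound is continuous in `d`. -/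
theorem frequently_isRemezExponent {N : ℕ} {f : EuclideanSpace ℂ (Fin N) → ℂ}
    (hD : chebyshevDegree f ≠ ∞) :
    ∃ᶠ d in nhds (chebyshevDegree f).toReal, 0 < d ∧ IsRemezExponent f d := by
  rw [Metric.nhds_basis_ball.frequently_iff]
  intro ε hε
  have hlt : chebyshevDegree f < ENNReal.ofReal ((chebyshevDegree f).toReal + ε) := by
    rw [ENNReal.lt_ofReal_iff_toReal_lt hD]
    linarith
  have hlt' := hlt
  conv_lhs at hlt' => rw [chebyshevDegree]
  simp only [iInf_lt_iff] at hlt'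
  obtain ⟨d, hd, hdlt⟩ := hlt'
  have hle : chebyshevDegree f ≤ ENNReal.ofReal d := iInf₂_le d hd
  rw [ENNReal.le_ofReal_iff_toReal_le hD hd.1.le] at hle
  have hdlt' := (ENNReal.ofReal_lt_ofReal_iff_of_nonneg hd.1.le).1 hdlt
  refine ⟨d, ?_, hd⟩
  rw [Metric.mem_ball, Real.dist_eq, abs_lt]
  constructor <;> linarith

theorem mainTheorem1 {N k : ℕ} {r : ℝ} (hr : 1 < r)
    (f : EuclideanSpace ℂ (Fin N) → ℂ)
    (hf : DifferentiableOn ℂ f (Metric.ball (0 : EuclideanSpace ℂ (Fin N)) r))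
    -- the real affine `k`-plane, as the image of an isometric affine embedding of `ℝ^k`
    (φ : EuclideanSpace ℝ (Fin k) →ᵃⁱ[ℝ] EuclideanSpace ℂ (Fin N))
    (V : Set (EuclideanSpace ℝ (Fin k)))
    (hVcompact : IsCompact V) (hVconvex : Convex ℝ V) (hVint : (interior V).Nonempty)
    (hVball : φ '' V ⊆ Metric.ball (0 : EuclideanSpace ℂ (Fin N)) 1)
    (h : EuclideanSpace ℝ (Fin k) → ℝ) (hh : IsLogConcave h)
    (hsupp : Function.support h ⊆ V) (hmass : 0 < densityMeasure h V)
    (m n p q : ℝ) (hm : 0 < m) (hn : 0 < n) (hp : 0 < p) (hq : 0 < q)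
    (hmnpq : m * n = p * q) (hpd : ENNReal.ofReal p < 1 / chebyshevDegree f) :
    powerAverage (densityMeasure h) V (fun x => f (φ x)) m ^ n *
        powerAverage (densityMeasure h) V (fun x => f (φ x)) (-p) ^ q ≤
      ENNReal.ofReal
        ((2 * Real.exp 1) ^ (n + q) *
          (4 : ℝ) ^ ((m * n + p * q) * (chebyshevDegree f).toReal) *
          (Real.Gamma (m * (chebyshevDegree f).toReal + 1) ^ n /
            (1 - p * (chebyshevDegree f).toReal) ^ q)) := by
  have hD : chebyshevDegree f ≠ ∞ := by
    intro htop
    rw [htop, one_div, ENNReal.inv_top] at hpd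
    exact not_lt_zero hpd
  set δ := (chebyshevDegree f).toReal with hδ
  have hδ0 : 0 ≤ δ := ENNReal.toReal_nonneg
  have hpδ : p * δ < 1 := by
    rw [ENNReal.lt_div_iff_mul_lt (Or.inr ENNReal.ofReal_ne_top) (Or.inl hD),
      ← ENNReal.ofReal_toReal hD, ← ENNReal.ofReal_mul hp.le, ← ENNReal.ofReal_one,
      ENNReal.ofReal_lt_ofReal_iff zero_lt_one] at hpd
    exact hpd
  have hcont := continuousAt_momentBound_mul_negMomentBound hm hn hq hδ0 hpδ
  have hfball : ContinuousOn f (Metric.ball (0 : EuclideanSpace ℂ (Fin N)) 1) :=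
    hf.continuousOn.mono (Metric.ball_subset_ball hr.le)
  have hnear : ∀ᶠ d in nhds δ, p * d < 1 :=
    (continuous_const.mul continuous_id).continuousAt.eventually (gt_mem_nhds hpδ)
  -- The left side does not depend on d, so the bound passes to the limit along admissible exponents
  -- near δ, where p * d < 1 still holds.
  refine le_trans (ge_of_tendsto_of_frequently
    ((ENNReal.continuous_ofReal.tendsto _).comp hcont) ?_)
    (ENNReal.ofReal_le_ofReal (momentBound_mul_negMomentBound_le hn hm hδ0 hpδ))
  refine ((frequently_isRemezExponent hD).and_eventually hnear).mono fun d hd => ?_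
  exact powerAverage_product_le f hfball φ V hVcompact hVconvex hVball h hh hsupp hmass hm hn hp hq
    hmnpq hd.1.1 hd.1.2 hd.2
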